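/- Let $K=\mathbb C(x,y,z)$ with the derivations $\partial_x,\partial_y,\partial_z$. For a differential extension $L$ of $K$ (an extension field with three commuting derivations extending these), differential forms over $L$ are forms in $dx,dy,dz$ with coefficients in $L$, and $L'$ is the space of 1-forms over $L$. A *Liouvillian extension* of $K$ is a differential extension $L$ of $K$ with the same field of constants as $K$ and a finite tower $K=K_0\subset K_1\subset\dots\subset K_m=L$ with $K_{i+1}=K_i(t_i)$, where for each $i$ either $t_i\ne0$ and $\partial t_i/t_i\in K_i$ for all three derivations $\partial$, or $\partial t_i\in K_i$ for all three $\partial$, or $t_i$ is algebraic over $K_i$. A *Liouvillian first integral* of a 2-form $\Omega$ over $K$ is a non-constant element $\phi$ of some Liouvillian extension of $K$ with $d\phi\wedge\Omega=0$. A *Darboux function* is a function $m=\exp(g/f)\prod_i f_i^{a_i}$ with finitely many nonzero $f_i\in\mathbb C[x,y,z]$, $a_i\in\mathbb C$, and $g,f\in\mathbb C[x,y,z]$, $f\neq 0$; that is, a nonzero element $m$ of a differential extension of $K$ with $\frac{dm}{m}=d\left(\frac gf\right)+\sum_i a_i\frac{df_i}{f_i}$. **Theorem.** Let $P,Q,R\in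 K$ and $\Omega=P\,dy\wedge dz+Q\,dz\wedge dx+R\,dx\wedge dy$. If $\Omega$ has a Liouvillian first integral, then at least one of the following holds. (I) There exist 1-forms $\omega,\alpha\in K'$ such that $$\omega\ne0,\qquad \omega\wedge\Omega=0,\qquad d\omega=\alpha\wedge\omega,\qquad d\alpha=0,$$ and there exist a Liouvillian extension $L$ of $K$, a Darboux function $m\in L$ with $dm/m=\alpha$, and $\phi\in L$ with $d\phi=\omega/m$ such that $\phi$ is a first integral of $\Omega$ (so $\phi=\int\omega/m$ with $m=e^{\int\alpha}$). (II) There exists a 1-form $\beta\in K'$ such that $$d\Omega=\beta\wedge\Omega,\qquad d\beta=0,$$ and there exist a Liouvillian extension $L$ of $K$ and a Darboux function $m\in L$ with $dm/m=\beta$ (so $m=e^{\int\beta}$) which is an inverse Jacobi multiplier of $\Omega$, that is, $d(\Omega/m)=0$. -/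

import Mathlib

universe u v

noncomputable section

/-- A field with three pairwise commuting derivations, written `∂ 0`, `∂ 1`, `∂ 2` and playing
the role of `∂/∂x`, `∂/∂y`, `∂/∂z`. -/
class DiffField (L : Type u) [Field L] where
  /-- The three derivations. -/
  partialD : Fin 3 → Derivation ℤ L L
  /-- They commute. -/
  comm : ∀ (i j : Fin 3) (a : L), partialD i (partialD j a) = partialD j (partialD i a)

/-- `L` is a differential extension of `K`: each derivation of `L` restricts to the
corresponding derivation of `K`. -/
class DiffExtension (K : Type u) (L : Type v) [Field K] [Field L] [DiffField K] [DiffField L]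
    [Algebra K L] : Prop where
  partialD_algebraMap : ∀ (i : Fin 3) (a : K),
    DiffField.partialD i (algebraMap K L a) = algebraMap K L (DiffField.partialD i a)

/-- An element killed by all the derivations. -/
def IsConst {L : Type u} [Field L] [DiffField L] (a : L) : Prop :=
  ∀ i : Fin 3, DiffField.partialD i a = 0

section RationalFunctions

/-- The polynomial ring `ℂ[x,y,z]`. -/
abbrev Poly3 : Type := MvPolynomial (Fin 3) ℂ

/-- The rational function field `ℂ(x,y,z)`. -/
abbrev Rat3 : Type := FractionRing Poly3

namespace FracDeriv

variable {C A F : Type*} [CommRing C] [CommRing A] [IsDomain A] [Algebra C A] [Field F]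
  [Algebra A F] [IsFractionRing A F] (D : Derivation C A A)

/-- The extension of a derivation of an integral domain to its field of fractions, by the quotient
rule `(p / q)' = (p' q - p q') / q ^ 2`. -/
def fn (r : F) : F :=
  let p : A := (IsLocalization.sec (nonZeroDivisors A) r).1
  let q : A := (IsLocalization.sec (nonZeroDivisors A) r).2
  algebraMap A F (D p * q - p * D q) / algebraMap A F q ^ 2

theorem algebraMap_ne {q : A} (hq : q ≠ 0) : algebraMap A F q ≠ 0 := fun h =>
  hq (IsFractionRing.injective A F (by simpa using h))

theorem exists_div (r : F) : ∃ p q : A, q ≠ 0 ∧ r = algebraMap A F p / algebraMap A F q := by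
  obtain ⟨p, q, hq, h⟩ := IsFractionRing.div_surjective (A := A) r
  exact ⟨p, q, nonZeroDivisors.ne_zero hq, h.symm⟩

/-- The quotient rule holds for every representation as a fraction. -/
theorem fn_div (p q : A) (hq : q ≠ 0) :
    fn D (algebraMap A F p / algebraMap A F q) =
      algebraMap A F (D p * q - p * D q) / algebraMap A F q ^ 2 := by
  have inj := IsFractionRing.injective A F
  unfold fn
  set r : F := algebraMap A F p / algebraMap A F q with hr
  have hs := IsLocalization.sec_spec (nonZeroDivisors A) r
  have hb0 : ((IsLocalization.sec (nonZeroDivisors A) r).2 : A) ≠ 0 :=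
    nonZeroDivisors.ne_zero (IsLocalization.sec (nonZeroDivisors A) r).2.2
  generalize (IsLocalization.sec (nonZeroDivisors A) r).1 = a at *
  generalize ((IsLocalization.sec (nonZeroDivisors A) r).2 : A) = b at *
  have hq' : algebraMap A F q ≠ 0 := algebraMap_ne hq
  have hb' : algebraMap A F b ≠ 0 := algebraMap_ne hb0
  have h1 : p * b = a * q := by
    apply inj
    rw [map_mul, map_mul]
    rw [hr, div_mul_eq_mul_div, div_eq_iff hq'] at hs
    exact hs
  have h2 := congrArg D h1
  simp only [Derivation.leibniz, smul_eq_mul] at h2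
  dsimp only
  rw [div_eq_div_iff (pow_ne_zero 2 hb') (pow_ne_zero 2 hq'), ← map_pow, ← map_pow, ← map_mul,
    ← map_mul]
  congr 1
  linear_combination (-b * q) * h2 + (D b * q + D q * b) * h1

theorem fn_algebraMap (p : A) : fn D (algebraMap A F p) = algebraMap A F (D p) := by
  have h := fn_div (F := F) D p 1 one_ne_zero
  simpa using h

theorem fn_add (r s : F) : fn D (r + s) = fn D r + fn D s := by
  obtain ⟨a, b, hb, rfl⟩ := exists_div (A := A) r
  obtain ⟨c, d, hd, rfl⟩ := exists_div (A := A) s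
  have hb' : algebraMap A F b ≠ 0 := algebraMap_ne hb
  have hd' : algebraMap A F d ≠ 0 := algebraMap_ne hd
  rw [div_add_div _ _ hb' hd', ← map_mul, ← map_mul, ← map_mul, ← map_add,
    fn_div D _ _ (mul_ne_zero hb hd), fn_div D _ _ hb, fn_div D _ _ hd]
  simp only [map_add, map_sub, map_mul, Derivation.leibniz, smul_eq_mul]
  field_simp
  ring

theorem fn_mul (r s : F) : fn D (r * s) = r * fn D s + s * fn D r := by
  obtain ⟨a, b, hb, rfl⟩ := exists_div (A := A) r
  obtain ⟨c, d, hd, rfl⟩ := exists_div (A := A) s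
  have hb' : algebraMap A F b ≠ 0 := algebraMap_ne hb
  have hd' : algebraMap A F d ≠ 0 := algebraMap_ne hd
  rw [div_mul_div_comm, ← map_mul, ← map_mul,
    fn_div D _ _ (mul_ne_zero hb hd), fn_div D _ _ hb, fn_div D _ _ hd]
  simp only [map_add, map_sub, map_mul, Derivation.leibniz, smul_eq_mul]
  field_simp
  ring

/-- The extended derivation, as a derivation of the field of fractions. -/
def der : Derivation ℤ F F where
  toFun r := fn D r
  map_add' r s := fn_add D r s
  map_smul' n r := by
    exact map_zsmul (AddMonoidHom.mk' (fn D : F → F) (fn_add D)) n r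
  map_one_eq_zero' := by
    change fn D (1 : F) = 0
    have h := fn_mul (F := F) D 1 1
    simpa using h
  leibniz' r s := fn_mul D r s

theorem der_algebraMap (p : A) : der D (algebraMap A F p) = algebraMap A F (D p) :=
  fn_algebraMap D p

theorem der_comm (D₁ D₂ : Derivation C A A) (h : ∀ p, D₁ (D₂ p) = D₂ (D₁ p)) (r : F) :
    der D₁ (der D₂ r) = der D₂ (der D₁ r) := by
  let D : Derivation ℤ F F := ⁅(der D₁ : Derivation ℤ F F), (der D₂ : Derivation ℤ F F)⁆
  have hD : ∀ s, D s = der D₁ (der D₂ s) - der D₂ (der D₁ s) := fun s =>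
    Derivation.commutator_apply s
  have hp : ∀ p : A, D (algebraMap A F p) = 0 := fun p => by
    rw [hD]
    simp only [der_algebraMap, h p, sub_self]
  obtain ⟨a, b, hb, rfl⟩ := exists_div (A := A) r
  rw [← sub_eq_zero, ← hD]
  have hb' : algebraMap A F b ≠ 0 := algebraMap_ne hb
  have h := D.leibniz (algebraMap A F a / algebraMap A F b) (algebraMap A F b)
  rw [div_mul_cancel₀ _ hb', hp, hp, smul_zero, zero_add, smul_eq_mul] at h
  exact (mul_eq_zero.mp h.symm).resolve_left hb'

end FracDeriv

theorem pderiv_comm (i j : Fin 3) (p : Poly3) :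
    MvPolynomial.pderiv i (MvPolynomial.pderiv j p) =
      MvPolynomial.pderiv j (MvPolynomial.pderiv i p) := by
  have : ⁅(MvPolynomial.pderiv i : Derivation ℂ Poly3 Poly3),
      (MvPolynomial.pderiv j : Derivation ℂ Poly3 Poly3)⁆ = 0 := by
    apply MvPolynomial.derivation_ext
    intro k
    rw [Derivation.commutator_apply, MvPolynomial.pderiv_X, MvPolynomial.pderiv_X]
    simp only [Pi.single_apply]
    split_ifs <;> simp
  have h := congrArg (fun D : Derivation ℂ Poly3 Poly3 => D p) this
  simpa [Derivation.commutator_apply, sub_eq_zero] using h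

/-- `ℂ(x,y,z)` with the usual partial derivatives, which extend those of polynomials. -/
instance instDiffFieldRat3 : DiffField Rat3 where
  partialD i := FracDeriv.der (MvPolynomial.pderiv i : Derivation ℂ Poly3 Poly3)
  comm i j a := FracDeriv.der_comm _ _ (pderiv_comm i j) a

end RationalFunctions

section Forms

variable {L : Type u} [Field L]

/-- The 1-form `a 0 dx + a 1 dy + a 2 dz`, given by its coefficients. -/
abbrev OneForm (L : Type u) : Type u := Fin 3 → L

/-- The 2-form `A 0 dy ∧ dz + A 1 dz ∧ dx + A 2 dx ∧ dy`, given by its coefficients. -/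
abbrev TwoForm (L : Type u) : Type u := Fin 3 → L

/-- The 3-form `c dx ∧ dy ∧ dz`, given by its coefficient. -/
abbrev ThreeForm (L : Type u) : Type u := L

/-- The wedge product of two 1-forms. -/
def wedgeOneOne (a b : OneForm L) : TwoForm L :=
  ![a 1 * b 2 - a 2 * b 1, a 2 * b 0 - a 0 * b 2, a 0 * b 1 - a 1 * b 0]

/-- The wedge product of a 1-form and a 2-form. -/
def wedgeOneTwo (a : OneForm L) (A : TwoForm L) : ThreeForm L :=
  a 0 * A 0 + a 1 * A 1 + a 2 * A 2

variable [DiffField L]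

/-- The differential of a function. -/
def dZero (f : L) : OneForm L := fun i => DiffField.partialD i f

/-- The exterior derivative of a 1-form. -/
def dOne (a : OneForm L) : TwoForm L :=
  ![DiffField.partialD 1 (a 2) - DiffField.partialD 2 (a 1),
    DiffField.partialD 2 (a 0) - DiffField.partialD 0 (a 2),
    DiffField.partialD 0 (a 1) - DiffField.partialD 1 (a 0)]

/-- The exterior derivative of a 2-form. -/
def dTwo (A : TwoForm L) : ThreeForm L :=
  DiffField.partialD 0 (A 0) + DiffField.partialD 1 (A 1) + DiffField.partialD 2 (A 2)

end Forms

/-- Extension of scalars for forms (used for 1-forms and for 2-forms). -/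
def formMap {K : Type u} (L : Type v) [Field K] [Field L] [Algebra K L] (a : Fin 3 → K) :
    Fin 3 → L :=
  fun i => algebraMap K L (a i)

section Liouvillian

variable (K : Type u) (L : Type v) [Field K] [Field L] [DiffField L] [Algebra K L]

/-- One step `E ⊂ E(t)` of a Liouvillian tower: `t` is an exponential of an integral, or an
integral, or algebraic. If `E` is closed under the derivations then `E(t)` is, too, so that all
the members of a tower are differential fields. -/
def LiouvillianStep (E F : IntermediateField K L) : Prop :=
  ∃ t : L, F = E ⊔ IntermediateField.adjoin K {t} ∧
    ((t ≠ 0 ∧ ∀ i : Fin 3, DiffField.partialD i t / t ∈ E) ∨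
      (∀ i : Fin 3, DiffField.partialD i t ∈ E) ∨
      IsAlgebraic E t)

/-- `L` is a Liouvillian extension of the differential field `K`: a differential extension
without new constants which is the top of a finite tower of Liouvillian steps. -/
structure IsLiouvillianExtension [DiffField K] : Prop where
  diffExtension : DiffExtension K L
  constants : ∀ a : L, IsConst a → ∃ c : K, IsConst c ∧ algebraMap K L c = a
  tower : ∃ (m : ℕ) (E : ℕ → IntermediateField K L), E 0 = ⊥ ∧ E m = ⊤ ∧
    ∀ i < m, LiouvillianStep K L (E i) (E (i + 1))

end Liouvillian

section Integrals

variable {L : Type u} [Field L] [DiffField L] [Algebra Rat3 L]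

/-- `φ` is a first integral of the rational 2-form `Ω`: it is non-constant and
`dφ ∧ Ω = 0`. -/
def IsFirstIntegral (Ω : TwoForm Rat3) (φ : L) : Prop :=
  ¬ IsConst φ ∧ wedgeOneTwo (dZero φ) (formMap L Ω) = 0

/-- `m` is an inverse Jacobi multiplier of the rational 2-form `Ω`: it is nonzero and
`d(Ω / m) = 0`. -/
def IsInverseJacobiMultiplier (Ω : TwoForm Rat3) (m : L) : Prop :=
  m ≠ 0 ∧ dTwo (m⁻¹ • formMap L Ω) = 0

/-- `m` is a Darboux function `exp (g / f) ∏ fᵢ ^ aᵢ` with polynomials `g`, `f`, `fᵢ` and complex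
numbers `aᵢ`. In a differential field (where exponentials and complex powers are determined, up to
constant factors, by their logarithmic differentials) this says that
`dm / m = d(g / f) + ∑ aᵢ dfᵢ / fᵢ`. -/
def IsDarbouxFunction (m : L) : Prop :=
  m ≠ 0 ∧ ∃ (g f : Poly3) (k : ℕ) (p : Fin k → Poly3) (a : Fin k → ℂ),
    f ≠ 0 ∧ (∀ i, p i ≠ 0) ∧
    m⁻¹ • dZero m = formMap L
      (dZero (algebraMap Poly3 Rat3 g / algebraMap Poly3 Rat3 f) +
        ∑ i, (algebraMap ℂ Rat3 (a i) / algebraMap Poly3 Rat3 (p i)) •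
          dZero (algebraMap Poly3 Rat3 (p i)))

end Integrals

/-- `Ω` has a Liouvillian first integral, that is, a first integral in some Liouvillian extension
of `ℂ(x,y,z)`. -/
def HasLiouvillianFirstIntegral (Ω : TwoForm Rat3) : Prop :=
  ∃ (L : Type u) (_ : Field L) (_ : DiffField L) (_ : Algebra Rat3 L),
    IsLiouvillianExtension Rat3 L ∧ ∃ φ : L, IsFirstIntegral Ω φ

end

/-! A closed multiplier is either a nonzero 1-form ω with ω ∧ Ω = 0 and dω = α ∧ ω for some closed
α, or a closed β with dΩ = β ∧ Ω. A first integral φ in L provides one over L, with ω = dφ and α =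
0. The heart of the proof, `hasClosedMultiplier_of_tower`, is that closed multipliers descend
through each step E ⊂ F = E(t) of the tower.

The descent has two stages. Normalise ω so that one coefficient is 1, and take E-endomorphisms of F
which commute with the derivations and have common fixed field E: a Galois group (after passing to a
normal closure), t ↦ 2t, or t ↦ t + 1. If all of them fix ω, it is defined over E. If some σ moves
it, then ω and σω are independent, Ω = h ω ∧ σω, and dh/h + α + σα is a closed multiplier of Ω
itself (`HasClosedMultiplier.in_of_automorphisms`). Next, α or β has to be brought from F to E. For
algebraic t the normalised trace does this, and for an exponential t the constant term of the
polynomial part in t: both are E-linear and commute with the derivations. For a primitive t the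
constant terms work if the polynomial parts are constant; otherwise the top coefficients form a
nonzero closed 1-form over E annihilated by Ω, which is the first alternative with α = 0.

Over ℂ(x,y,z) two facts remain. A closed rational 1-form is the logarithmic differential of a
Darboux function (`mem_logForms_of_closed`, `isDarbouxForm_of_mem_logForms`): the variables are
eliminated one at a time by Hermite reduction, and closedness makes the residues complex numbers.
Moreover m = exp ∫α and φ = ∫ω/m exist in a Liouvillian extension (`exists_liouvillian_solution`):
both are power series at a regular point, and they generate a subfield of the fraction field of
ℂ[[x,y,z]], whose only constants are ℂ. -/

namespace LiouvillianForms

open DiffField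

/-! ### Exterior calculus in three variables and closed multipliers. -/

section Forms

variable {F : Type u} [Field F] [DiffField F]

theorem partialD_mul (i : Fin 3) (a b : F) :
    partialD i (a * b) = a * partialD i b + b * partialD i a := by
  rw [Derivation.leibniz, smul_eq_mul, smul_eq_mul]

theorem partialD_inv (i : Fin 3) (h : F) : partialD i h⁻¹ = -(partialD i h / h ^ 2) := by
  rw [Derivation.leibniz_inv, smul_eq_mul, div_eq_mul_inv, inv_pow]
  ring

/-- Replaces the cyclic coefficient vectors by identities indexed by pairs, to which linear maps and
automorphisms can be applied uniformly. -/
theorem wedgeOneOne_eq_dOne_iff (a w : OneForm F) :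
    wedgeOneOne a w = dOne w ↔
      ∀ i j, partialD i (w j) - partialD j (w i) = a i * w j - a j * w i := by
  constructor
  · intro h
    have h0 := congrFun h 0
    have h1 := congrFun h 1
    have h2 := congrFun h 2
    simp only [wedgeOneOne, dOne, Matrix.cons_val] at h0 h1 h2
    intro i j
    fin_cases i <;> fin_cases j <;> simp only [Fin.zero_eta, Fin.mk_one, Fin.reduceFinMk] <;>
      first
        | ring1
        | linear_combination -h0
        | linear_combination h0
        | linear_combination -h1
        | linear_combination h1
        | linear_combination -h2
        | linear_combination h2
  · intro h
    ext i
    fin_cases i <;> simp only [wedgeOneOne, dOne, Fin.zero_eta, Fin.mk_one, Fin.reduceFinMk,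
      Matrix.cons_val]
    · exact (h 1 2).symm
    · exact (h 2 0).symm
    · exact (h 0 1).symm

theorem dOne_eq_zero_iff (a : OneForm F) :
    dOne a = 0 ↔ ∀ i j, partialD i (a j) = partialD j (a i) := by
  have h := wedgeOneOne_eq_dOne_iff 0 a
  have h0 : wedgeOneOne (0 : OneForm F) a = 0 := by
    ext i
    fin_cases i <;> simp [wedgeOneOne]
  rw [h0, eq_comm] at h
  rw [h]
  simp [sub_eq_zero]

theorem wedgeOneOne_eq_zero_iff {F : Type u} [Field F] (a b : OneForm F) :
    wedgeOneOne a b = 0 ↔ ∀ i j, a i * b j = a j * b i := by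
  constructor
  · intro h
    have h0 := congrFun h 0
    have h1 := congrFun h 1
    have h2 := congrFun h 2
    simp only [wedgeOneOne, Matrix.cons_val, Pi.zero_apply] at h0 h1 h2
    intro i j
    fin_cases i <;> fin_cases j <;> simp only [Fin.zero_eta, Fin.mk_one, Fin.reduceFinMk] <;>
      first
        | ring1
        | linear_combination -h0
        | linear_combination h0
        | linear_combination -h1
        | linear_combination h1
        | linear_combination -h2
        | linear_combination h2
  · intro h
    ext i
    fin_cases i <;> simp only [wedgeOneOne, Fin.zero_eta, Fin.mk_one, Fin.reduceFinMk,
      Matrix.cons_val, Pi.zero_apply, sub_eq_zero]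
    · exact h 1 2
    · exact h 2 0
    · exact h 0 1

theorem dOne_dZero (f : F) : dOne (dZero f) = 0 := by
  rw [dOne_eq_zero_iff]
  exact fun i j => DiffField.comm i j f

theorem dOne_add (a b : OneForm F) : dOne (a + b) = dOne a + dOne b := by
  ext i
  fin_cases i <;> simp [dOne] <;> ring

theorem dOne_logDeriv (h : F) : dOne (h⁻¹ • dZero h) = 0 := by
  rw [dOne_eq_zero_iff]
  intro i j
  simp only [Pi.smul_apply, dZero, smul_eq_mul, Derivation.leibniz, partialD_inv, comm i j h]
  ring

/-- The condition which is passed down a Liouvillian tower: there is an integrable 1-form `ω`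
annihilated by `Ω` with a closed multiplier `α`, or `Ω` itself has a closed multiplier `β`. -/
def HasClosedMultiplier (Ω : TwoForm F) : Prop :=
  (∃ ω α : OneForm F, ω ≠ 0 ∧ wedgeOneTwo ω Ω = 0 ∧ wedgeOneOne α ω = dOne ω ∧ dOne α = 0) ∨
    ∃ β : OneForm F, dTwo Ω = wedgeOneTwo β Ω ∧ dOne β = 0

/-- Read as vectors, Ω is orthogonal to the independent `a` and `b`, hence parallel to their cross
product. The factor is the ratio at any nonzero component. -/
theorem exists_smul_wedge {F : Type u} [Field F] {Ω : TwoForm F} {a b : OneForm F}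
    (ha : wedgeOneTwo a Ω = 0) (hb : wedgeOneTwo b Ω = 0) (hab : wedgeOneOne a b ≠ 0) :
    ∃ h : F, Ω = h • wedgeOneOne a b := by
  simp only [wedgeOneTwo] at ha hb
  have key : ∃ i, wedgeOneOne a b i ≠ 0 := Function.ne_iff.mp hab
  obtain ⟨i, hi⟩ := key
  refine ⟨Ω i / wedgeOneOne a b i, ?_⟩
  ext j
  rw [Pi.smul_apply, smul_eq_mul, div_mul_eq_mul_div, eq_div_iff hi]
  fin_cases i <;> fin_cases j <;> simp only [wedgeOneOne, Fin.zero_eta, Fin.mk_one,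
      Fin.reduceFinMk, Matrix.cons_val]
  · linear_combination b 2 * ha - a 2 * hb
  · linear_combination -b 1 * ha + a 1 * hb
  · linear_combination -b 2 * ha + a 2 * hb
  · linear_combination b 0 * ha - a 0 * hb
  · linear_combination b 1 * ha - a 1 * hb
  · linear_combination -b 0 * ha + a 0 * hb

/-- Two independent integrable forms annihilated by `Ω` give a closed multiplier of `Ω`. -/
theorem exists_multiplier_of_independent {Ω : TwoForm F} {w₁ w₂ a₁ a₂ : OneForm F}
    (h₁ : wedgeOneTwo w₁ Ω = 0) (h₂ : wedgeOneTwo w₂ Ω = 0)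
    (hd₁ : wedgeOneOne a₁ w₁ = dOne w₁) (hd₂ : wedgeOneOne a₂ w₂ = dOne w₂)
    (hc₁ : dOne a₁ = 0) (hc₂ : dOne a₂ = 0) (hw : wedgeOneOne w₁ w₂ ≠ 0) :
    ∃ β : OneForm F, dTwo Ω = wedgeOneTwo β Ω ∧ dOne β = 0 := by
  obtain ⟨h, hΩ⟩ := exists_smul_wedge h₁ h₂ hw
  by_cases hh : h = 0
  · refine ⟨0, ?_, ?_⟩
    · simp [hΩ, hh, dTwo, wedgeOneTwo]
    · rw [dOne_eq_zero_iff]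
      simp
  -- d(h w₁ ∧ w₂) = dh ∧ w₁ ∧ w₂ + h (dw₁ ∧ w₂ − w₁ ∧ dw₂); inserting dwᵢ = aᵢ ∧ wᵢ gives (dh/h + a₁
  -- + a₂) ∧ Ω.
  refine ⟨h⁻¹ • dZero h + a₁ + a₂, ?_, ?_⟩
  · rw [wedgeOneOne_eq_dOne_iff] at hd₁ hd₂
    subst hΩ
    have e1 := hd₁ 0 1
    have e2 := hd₁ 1 2
    have e3 := hd₁ 2 0
    have f1 := hd₂ 0 1
    have f2 := hd₂ 1 2
    have f3 := hd₂ 2 0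
    simp only [dTwo, wedgeOneTwo, wedgeOneOne, Pi.smul_apply, smul_eq_mul, Pi.add_apply, dZero,
      Matrix.cons_val, Derivation.leibniz, map_sub]
    field_simp
    linear_combination h * (w₂ 2 * e1 + w₂ 0 * e2 + w₂ 1 * e3 - w₁ 2 * f1 - w₁ 0 * f2 - w₁ 1 * f3)
  · rw [dOne_add, dOne_add, dOne_logDeriv, hc₁, hc₂]
    simp

/-- Rescaling an integrable form changes the closed multiplier by a logarithmic differential. -/
theorem wedgeOneOne_smul_eq_dOne {w a : OneForm F} {h : F} (hh : h ≠ 0)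
    (hd : wedgeOneOne a w = dOne w) :
    wedgeOneOne (a + h⁻¹ • dZero h) (h • w) = dOne (h • w) := by
  rw [wedgeOneOne_eq_dOne_iff] at hd ⊢
  intro i j
  simp only [Pi.smul_apply, smul_eq_mul, Pi.add_apply, dZero, Derivation.leibniz]
  field_simp
  linear_combination h * hd i j

/-- The case α = 0. It starts the descent with dφ and reappears in primitive steps. -/
theorem hasClosedMultiplier_of_closed {Ω : TwoForm F} {w : OneForm F} (hw : w ≠ 0)
    (h : wedgeOneTwo w Ω = 0) (hd : dOne w = 0) : HasClosedMultiplier Ω := by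
  refine Or.inl ⟨w, 0, hw, h, ?_, ?_⟩
  · rw [hd, wedgeOneOne_eq_zero_iff]
    simp
  · rw [dOne_eq_zero_iff]
    simp

end Forms

/-! ### Base change, automorphisms and retractions. -/

section Extension

variable {E : Type u} {F : Type v} [Field E] [Field F] [Algebra E F]

theorem formMap_injective : Function.Injective (formMap (K := E) F) := fun a b h => by
  ext i
  exact (algebraMap E F).injective (congrFun h i)

theorem wedgeOneTwo_formMap (a : OneForm E) (A : TwoForm E) :
    wedgeOneTwo (formMap F a) (formMap F A) = algebraMap E F (wedgeOneTwo a A) := by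
  simp [wedgeOneTwo, formMap]

theorem wedgeOneOne_formMap (a b : OneForm E) :
    wedgeOneOne (formMap F a) (formMap F b) = formMap F (wedgeOneOne a b) := by
  ext i
  fin_cases i <;> simp [wedgeOneOne, formMap]

theorem formMap_zero : formMap F (0 : Fin 3 → E) = 0 := by
  ext i
  simp [formMap]

variable [DiffField F]

variable (F) in
/-- A closed multiplier with values in the extension `F`, for an integrable form over `E` or for
`Ω` itself. -/
def HasClosedMultiplierIn (Ω : TwoForm E) : Prop :=
  (∃ (ω : OneForm E) (α : OneForm F), ω ≠ 0 ∧ wedgeOneTwo ω Ω = 0 ∧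
      wedgeOneOne α (formMap F ω) = dOne (formMap F ω) ∧ dOne α = 0) ∨
    ∃ β : OneForm F, dTwo (formMap F Ω) = wedgeOneTwo β (formMap F Ω) ∧ dOne β = 0

/-- An automorphism which moves the normalised form gives a second, independent form. -/
theorem HasClosedMultiplier.in_of_automorphisms {Ω : TwoForm E} (S : Set (F →ₐ[E] F))
    (hcomm : ∀ σ ∈ S, ∀ i x, σ (partialD i x) = partialD i (σ x))
    (hfix : ∀ x : F, (∀ σ ∈ S, σ x = x) → ∃ a : E, algebraMap E F a = x)
    (h : HasClosedMultiplier (_root_.formMap F Ω)) : HasClosedMultiplierIn F Ω := by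
  rcases h with ⟨w, a, hw, h1, h2, h3⟩ | hβ
  swap
  · exact Or.inr hβ
  obtain ⟨j, hj⟩ := Function.ne_iff.mp hw
  rw [Pi.zero_apply] at hj
  have hj' : (w j)⁻¹ ≠ 0 := inv_ne_zero hj
  -- Dividing by `w j` makes the `j`-th coefficient 1, which leaves no freedom of rescaling:
  -- proportional forms with this normalisation are equal.
  have h2' := wedgeOneOne_smul_eq_dOne hj' h2
  have h3' : dOne (a + (w j)⁻¹⁻¹ • dZero (w j)⁻¹) = 0 := by
    rw [dOne_add, h3, dOne_logDeriv, add_zero]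
  have h1' : wedgeOneTwo ((w j)⁻¹ • w) (_root_.formMap F Ω) = 0 := by
    simp only [wedgeOneTwo, Pi.smul_apply, smul_eq_mul] at h1 ⊢
    linear_combination (w j)⁻¹ * h1
  have hone : ((w j)⁻¹ • w) j = 1 := by simp [hj]
  generalize (a + (w j)⁻¹⁻¹ • dZero (w j)⁻¹) = a' at *
  generalize ((w j)⁻¹ • w) = w' at *
  by_cases hσ : ∀ σ ∈ S, ∀ i, σ (w' i) = w' i
  · choose ω hω using fun i => hfix (w' i) fun σ hs => hσ σ hs i
    have hω' : w' = _root_.formMap F ω := funext fun i => (hω i).symm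
    rw [hω'] at h1' h2' hone
    refine Or.inl ⟨ω, a', ?_, ?_, h2', h3'⟩
    · rintro rfl
      simp [formMap_zero] at hone
    · rw [wedgeOneTwo_formMap] at h1'
      simpa using h1'
  · push Not at hσ
    obtain ⟨σ, hS, i, hi⟩ := hσ
    refine Or.inr (exists_multiplier_of_independent (w₁ := w') (w₂ := fun i => σ (w' i))
      (a₁ := a') (a₂ := fun i => σ (a' i)) h1' ?_ h2' ?_ h3' ?_ ?_)
    · have := congrArg σ h1'
      simpa [wedgeOneTwo, _root_.formMap] using this
    · rw [wedgeOneOne_eq_dOne_iff] at h2' ⊢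
      intro i j
      have := congrArg σ (h2' i j)
      simpa [hcomm σ hS] using this
    · rw [dOne_eq_zero_iff] at h3' ⊢
      intro i j
      have := congrArg σ (h3' i j)
      simpa [hcomm σ hS] using this
    -- Both forms have `j`-th coefficient 1, so a vanishing wedge product would make σ fix the
    -- `i`-th coefficient.
    · rw [Ne, wedgeOneOne_eq_zero_iff]
      intro hp
      have := hp i j
      simp only [hone, map_one, one_mul, mul_one] at this
      exact hi this.symm

variable [DiffField E] [DiffExtension E F]

theorem partialD_algebraMap (i : Fin 3) (a : E) :
    partialD i (algebraMap E F a) = algebraMap E F (partialD i a) :=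
  DiffExtension.partialD_algebraMap i a

theorem dTwo_formMap (A : TwoForm E) : dTwo (formMap F A) = algebraMap E F (dTwo A) := by
  simp [dTwo, formMap, partialD_algebraMap]

theorem dOne_formMap (a : OneForm E) : dOne (formMap F a) = formMap F (dOne a) := by
  ext i
  fin_cases i <;> simp [dOne, formMap, partialD_algebraMap]

theorem HasClosedMultiplier.formMap {Ω : TwoForm E} (h : HasClosedMultiplier Ω) :
    HasClosedMultiplier (formMap F Ω) := by
  rcases h with ⟨w, a, hw, h1, h2, h3⟩ | ⟨b, h1, h2⟩
  · refine Or.inl ⟨_root_.formMap F w, _root_.formMap F a, fun h => hw ?_, ?_, ?_, ?_⟩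
    · exact formMap_injective (h.trans formMap_zero.symm)
    · rw [wedgeOneTwo_formMap, h1, map_zero]
    · rw [wedgeOneOne_formMap, h2, dOne_formMap]
    · rw [dOne_formMap, h3, formMap_zero]
  · refine Or.inr ⟨_root_.formMap F b, ?_, ?_⟩
    · rw [dTwo_formMap, h1, wedgeOneTwo_formMap]
    · rw [dOne_formMap, h2, formMap_zero]

/-- A retraction commuting with the derivations takes closed multipliers to closed multipliers. -/
theorem HasClosedMultiplierIn.of_retraction {Ω : TwoForm E} (ρ : F →ₗ[E] E) (hρ : ρ 1 = 1)
    (hcomm : ∀ i x, ρ (partialD i x) = partialD i (ρ x)) (h : HasClosedMultiplierIn F Ω) :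
    HasClosedMultiplier Ω := by
  have hE : ∀ a, ρ (algebraMap E F a) = a := fun a => by
    rw [Algebra.algebraMap_eq_smul_one, map_smul, hρ, smul_eq_mul, mul_one]
  have hr : ∀ (x : F) (a : E), ρ (x * algebraMap E F a) = ρ x * a := fun x a => by
    rw [mul_comm, ← Algebra.smul_def, map_smul, smul_eq_mul, mul_comm]
  rcases h with ⟨w, a, hw, h1, h2, h3⟩ | ⟨b, h1, h2⟩
  · refine Or.inl ⟨w, fun i => ρ (a i), hw, h1, ?_, ?_⟩
    · rw [wedgeOneOne_eq_dOne_iff] at h2 ⊢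
      intro i j
      have := congrArg ρ (h2 i j)
      simpa [formMap, hr, hE, partialD_algebraMap, hcomm] using this
    · rw [dOne_eq_zero_iff] at h3 ⊢
      intro i j
      have := congrArg ρ (h3 i j)
      simpa [hcomm] using this
  · refine Or.inr ⟨fun i => ρ (b i), ?_, ?_⟩
    · rw [dTwo_formMap] at h1
      have := congrArg ρ h1
      simpa [wedgeOneTwo, formMap, hr, hE] using this
    · rw [dOne_eq_zero_iff] at h2 ⊢
      intro i j
      have := congrArg ρ (h2 i j)
      simpa [hcomm] using this

end Extension

end LiouvillianForms

namespace LiouvillianForms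

open DiffField Polynomial

/-! ### Differentiating polynomials coefficientwise. -/

section CoefficientDerivation

variable {E : Type u} [Field E] [DiffField E]

/-- The derivation of `E[X]` acting on the coefficients by `∂ i`. -/
noncomputable def coeffD (i : Fin 3) : Derivation ℤ E[X] E[X] :=
  let : Differential E := ⟨partialD i⟩
  Differential.mapCoeffs

theorem coeff_coeffD (i : Fin 3) (p : E[X]) (n : ℕ) :
    (coeffD i p).coeff n = partialD i (p.coeff n) := rfl

theorem coeffD_C (i : Fin 3) (a : E) : coeffD i (C a) = C (partialD i a) :=
  let : Differential E := ⟨partialD i⟩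
  Differential.mapCoeffs_C a

theorem degree_coeffD_le (i : Fin 3) (p : E[X]) : (coeffD i p).degree ≤ p.degree := by
  rw [degree_le_iff_coeff_zero]
  intro n hn
  rw [coeff_coeffD, coeff_eq_zero_of_degree_lt hn, map_zero]

theorem coeffD_derivative (i : Fin 3) (p : E[X]) :
    coeffD i (derivative p) = derivative (coeffD i p) := by
  ext n
  rw [coeff_coeffD, coeff_derivative, coeff_derivative, coeff_coeffD, Derivation.leibniz]
  have : partialD i ((n : E) + 1) = 0 := by
    have := (partialD (L := E) i).map_natCast (n + 1)
    exact_mod_cast this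
  rw [this]
  simp [mul_comm]

variable {F : Type v} [Field F] [DiffField F] [Algebra E F] [DiffExtension E F]

theorem partialD_aeval (i : Fin 3) (x : F) (p : E[X]) :
    partialD i (aeval x p) =
      aeval x (coeffD i p) + aeval x (derivative p) * partialD i x := by
  let : Differential E := ⟨partialD i⟩
  let : Differential F := ⟨partialD i⟩
  have : DifferentialAlgebra E F := ⟨partialD_algebraMap i⟩
  exact Differential.deriv_aeval_eq x p

end CoefficientDerivation

theorem partialD_div {F : Type u} [Field F] [DiffField F] (i : Fin 3) (a b : F) (hb : b ≠ 0) :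
    partialD i (a / b) = (partialD i a * b - a * partialD i b) / b ^ 2 := by
  rw [Derivation.leibniz_div, smul_eq_mul, smul_eq_mul, smul_eq_mul]
  field_simp

/-- A derivation which vanishes on a field vanishes on every element algebraic over it. -/
theorem derivation_eq_zero_of_isAlgebraic {k : Type u} {K : Type v} [Field k] [Field K]
    [Algebra k K] [CharZero k] (D : Derivation ℤ K K) (h : ∀ a, D (algebraMap k K a) = 0) {x : K}
    (hx : IsAlgebraic k x) : D x = 0 := by
  let D' : Derivation k K K := Derivation.mk'
    { toFun := D
      map_add' := map_add D
      map_smul' := fun a y => by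
        rw [Algebra.smul_def, Derivation.leibniz, h, smul_zero, add_zero, RingHom.id_apply,
          smul_eq_mul, Algebra.smul_def] }
    (fun a b => D.leibniz a b)
  have h1 := D'.map_aeval (minpoly k x) x
  rw [minpoly.aeval, map_zero, smul_eq_mul] at h1
  have hsep := (minpoly.irreducible hx.isIntegral).separable
  exact (mul_eq_zero.mp h1.symm).resolve_left (hsep.aeval_derivative_ne_zero (minpoly.aeval k x))

/-! ### Descent along algebraic extensions. -/

section Algebraic

/-- The derivations extend to a finite extension. -/
theorem exists_diffExtension (F : Type u) (N : Type v) [Field F] [Field N] [DiffField F]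
    [CharZero F] [Algebra F N] [FiniteDimensional F N] :
    ∃ _ : DiffField N, DiffExtension F N := by
  have key : ∀ i : Fin 3, ∃ D : Derivation ℤ N N, ∀ a : F,
      D (algebraMap F N a) = algebraMap F N (partialD i a) := fun i => by
    let : Differential F := ⟨partialD i⟩
    let : Differential N := Differential.differentialFiniteDimensional F N
    have : DifferentialAlgebra F N := Differential.differentialAlgebraFiniteDimensional
    exact ⟨Differential.deriv, fun a => DifferentialAlgebra.deriv_algebraMap a⟩
  choose D hD using key
  refine ⟨⟨D, fun i j a => ?_⟩, @DiffExtension.mk F N _ _ _ ⟨D, _⟩ _ hD⟩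
  -- The commutator of two extended derivations vanishes on `F`, hence on the algebraic extension
  -- `N`.
  have h := derivation_eq_zero_of_isAlgebraic (k := F) ⁅D i, D j⁆ (fun b => by
    rw [Derivation.commutator_apply, hD, hD, hD, hD, comm i j b, sub_self])
    (Algebra.IsAlgebraic.isAlgebraic a)
  rwa [Derivation.commutator_apply, sub_eq_zero] at h

variable {E : Type u} [Field E] [DiffField E] [CharZero E]

theorem algEquiv_partialD {N : Type v} [Field N] [DiffField N] [Algebra E N] [DiffExtension E N]
    [Algebra.IsAlgebraic E N] (σ : N ≃ₐ[E] N) (i : Fin 3) (x : N) :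
    σ (partialD i x) = partialD i (σ x) := by
  let : Differential E := ⟨partialD i⟩
  let : Differential N := ⟨partialD i⟩
  have : DifferentialAlgebra E N := ⟨partialD_algebraMap i⟩
  exact Differential.algEquiv_deriv' σ x

/-- The Galois group has fixed field `E` and commutes with the derivations, since these extend
uniquely to an algebraic extension. So does the trace, a sum of conjugates; dividing it by the
degree makes it a retraction onto `E`. -/
theorem HasClosedMultiplier.of_galois {N : Type v} [Field N] [DiffField N] [Algebra E N]
    [DiffExtension E N] [FiniteDimensional E N] [IsGalois E N] {Ω : TwoForm E}
    (h : HasClosedMultiplier (_root_.formMap N Ω)) : HasClosedMultiplier Ω := by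
  have hin := h.in_of_automorphisms (Set.range fun σ : N ≃ₐ[E] N => (σ : N →ₐ[E] N)) (by
      rintro _ ⟨σ, rfl⟩ i x
      exact algEquiv_partialD σ i x) (by
      intro x hx
      have := (IsGalois.mem_range_algebraMap_iff_fixed (F := E) x).mpr fun σ => hx σ ⟨σ, rfl⟩
      exact this)
  have hn : (Module.finrank E N : E) ≠ 0 := by
    exact_mod_cast Module.finrank_pos.ne'
  refine hin.of_retraction ((Module.finrank E N : E)⁻¹ • Algebra.trace E N) ?_ ?_
  · rw [LinearMap.smul_apply, ← map_one (algebraMap E N), Algebra.trace_algebraMap, smul_eq_mul,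
      nsmul_eq_mul, mul_one, inv_mul_cancel₀ hn]
  · intro i x
    have hc : partialD i ((Module.finrank E N : E)⁻¹) = 0 := by
      rw [partialD_inv, Derivation.map_natCast]
      simp
    rw [LinearMap.smul_apply, LinearMap.smul_apply, smul_eq_mul, smul_eq_mul, Derivation.leibniz,
      hc, smul_zero, add_zero, smul_eq_mul]
    congr 1
    apply (algebraMap E N).injective
    rw [← partialD_algebraMap, trace_eq_sum_automorphisms, trace_eq_sum_automorphisms, map_sum]
    exact Finset.sum_congr rfl fun σ _ => algEquiv_partialD σ i x

/-- A closed multiplier can be lifted freely, here to the normal closure, from which Galois descent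
leads back to `E`. -/
theorem HasClosedMultiplier.of_finiteDimensional {F : Type v} [Field F] [DiffField F]
    [Algebra E F] [DiffExtension E F] [FiniteDimensional E F] {Ω : TwoForm E}
    (h : HasClosedMultiplier (_root_.formMap F Ω)) : HasClosedMultiplier Ω := by
  let N := IntermediateField.normalClosure E F (AlgebraicClosure F)
  have : CharZero F := charZero_of_injective_algebraMap (algebraMap E F).injective
  have : FiniteDimensional F N := FiniteDimensional.right E F N
  obtain ⟨_, hN⟩ := exists_diffExtension F N
  have : DiffExtension E N := ⟨fun i a => by
    rw [IsScalarTower.algebraMap_apply E F N, partialD_algebraMap, partialD_algebraMap,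
      ← IsScalarTower.algebraMap_apply]⟩
  have : IsGalois E N := { }
  refine HasClosedMultiplier.of_galois (N := N) ?_
  have := h.formMap (F := N)
  have he : _root_.formMap N (_root_.formMap F Ω) = _root_.formMap N Ω := by
    ext i
    simp only [_root_.formMap, ← IsScalarTower.algebraMap_apply]
  rwa [he] at this

end Algebraic

end LiouvillianForms

namespace LiouvillianForms

open DiffField Polynomial IntermediateField

/-! ### Descent along a transcendental generator. -/

section Transcendental

variable {E : Type u} {F : Type v} [Field E] [Field F] [Algebra E F] {t : F}

theorem aeval_ne_zero_of_transcendental (ht : Transcendental E t) {p : E[X]} (hp : p ≠ 0) :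
    aeval t p ≠ 0 := fun h => ht ⟨p, hp, h⟩

theorem exists_eq_div_of_mem_adjoin {x : F} (hx : x ∈ E⟮t⟯) :
    ∃ r s : E[X], s ≠ 0 ∧ x = aeval t r / aeval t s := by
  obtain ⟨r, s, h⟩ := (mem_adjoin_simple_iff E x).mp hx
  by_cases hs : s = 0
  -- A zero denominator gives the default value 0 of division, rewritten as 0 / 1.
  · exact ⟨0, 1, one_ne_zero, by simp [h, hs]⟩
  · exact ⟨r, s, hs, h⟩

theorem exists_eq_div (hE : E⟮t⟯ = ⊤) (x : F) :
    ∃ r s : E[X], s ≠ 0 ∧ x = aeval t r / aeval t s :=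
  exists_eq_div_of_mem_adjoin (hE ▸ mem_top)

/-- The substitution `t ↦ u` for a second transcendental element `u`. -/
theorem exists_algHom_apply_eq (hE : E⟮t⟯ = ⊤) (ht : Transcendental E t) {u : F}
    (hu : Transcendental E u) : ∃ σ : F →ₐ[E] F, σ t = u := by
  let e₁ := RatFunc.algEquivOfTranscendental t ht
  let e₂ := RatFunc.algEquivOfTranscendental u hu
  let e₀ : F ≃ₐ[E] E⟮t⟯ := (topEquiv.symm.trans (equivOfEq hE.symm))
  refine ⟨(E⟮u⟯.val.comp e₂.toAlgHom).comp (e₁.symm.toAlgHom.comp e₀.toAlgHom), ?_⟩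
  have h : e₁.symm (e₀ t) = RatFunc.X := by
    rw [AlgEquiv.symm_apply_eq]
    apply Subtype.ext
    rw [RatFunc.algEquivOfTranscendental_X]
    rfl
  change ((e₂ (e₁.symm (e₀ t)) : E⟮u⟯) : F) = u
  rw [h]
  exact RatFunc.algEquivOfTranscendental_X u hu

/-- A substitution of infinite order fixes only the constants. -/
theorem exists_algebraMap_eq_of_fixed (hE : E⟮t⟯ = ⊤) (ht : Transcendental E t) (σ : F →ₐ[E] F)
    (hσ : Function.Injective fun n : ℕ => (σ^[n]) t) {x : F} (hx : σ x = x) :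
    ∃ a : E, algebraMap E F a = x := by
  obtain ⟨r, s, hs, h⟩ := exists_eq_div hE x
  have hst := aeval_ne_zero_of_transcendental ht hs
  have hrs : ∀ n, aeval ((σ^[n]) t) r = x * aeval ((σ^[n]) t) s := by
    intro n
    induction n with
    | zero => rw [Function.iterate_zero, id, h, div_mul_cancel₀ _ hst]
    | succ n ih =>
      rw [Function.iterate_succ_apply', aeval_algHom_apply, aeval_algHom_apply, ih, map_mul, hx]
  -- Since σ fixes x = r(t)/s(t), the polynomial r − x s vanishes on the whole infinite orbit of
  -- `t`. Being zero, it exhibits `x` as a quotient of coefficients in `E`.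
  have hz : r.map (algebraMap E F) - C x * s.map (algebraMap E F) = 0 := by
    refine eq_zero_of_infinite_isRoot _ (Set.infinite_of_injective_forall_mem hσ fun n => ?_)
    have := hrs n
    simp only [Set.mem_ofPred_eq, IsRoot.def, eval_sub, eval_mul, eval_C, eval_map_algebraMap]
    rw [this, sub_self]
  obtain ⟨n, hn⟩ : ∃ n, s.coeff n ≠ 0 := by
    by_contra! h0
    exact hs (Polynomial.ext h0)
  refine ⟨r.coeff n / s.coeff n, ?_⟩
  have h2 := congrArg (fun p => coeff p n) hz
  simp only [coeff_sub, coeff_map, coeff_C_mul, coeff_zero] at h2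
  rw [map_div₀, div_eq_iff (by simpa using hn)]
  linear_combination h2

variable [DiffField E] [DiffField F] [DiffExtension E F]

theorem algHom_partialD (hE : E⟮t⟯ = ⊤) (ht : Transcendental E t) (σ : F →ₐ[E] F) (i : Fin 3)
    (hσ : σ (partialD i t) = partialD i (σ t)) (x : F) :
    σ (partialD i x) = partialD i (σ x) := by
  have hp : ∀ p : E[X], σ (partialD i (aeval t p)) = partialD i (σ (aeval t p)) := fun p => by
    rw [partialD_aeval, map_add, map_mul, hσ, ← aeval_algHom_apply, ← aeval_algHom_apply,
      ← aeval_algHom_apply, partialD_aeval]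
  obtain ⟨r, s, hs, rfl⟩ := exists_eq_div hE x
  have hst := aeval_ne_zero_of_transcendental ht hs
  have hst' : σ (aeval t s) ≠ 0 := by simpa using hst
  rw [partialD_div _ _ _ hst, map_div₀, map_div₀, partialD_div _ _ _ hst']
  simp only [map_sub, map_mul, map_pow, hp]

/-- One substitution `t ↦ u` with infinite orbit already has fixed field `E`, so it can play the
part of a Galois group. -/
theorem HasClosedMultiplier.in_of_substitution {Ω : TwoForm E} (hE : E⟮t⟯ = ⊤)
    (ht : Transcendental E t) {u : F} (hu : Transcendental E u)
    (hτ : ∀ σ : F →ₐ[E] F, σ t = u →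
      Function.Injective (fun n : ℕ => (σ^[n]) t) ∧ ∀ i, σ (partialD i t) = partialD i (σ t))
    (h : HasClosedMultiplier (_root_.formMap F Ω)) : HasClosedMultiplierIn F Ω := by
  obtain ⟨σ, hσ⟩ := exists_algHom_apply_eq hE ht hu
  obtain ⟨h1, h2⟩ := hτ σ hσ
  refine h.in_of_automorphisms {σ} ?_ ?_
  · intro σ' hσ' i x
    rw [Set.mem_singleton_iff.mp hσ']
    exact algHom_partialD hE ht σ i (h2 i) x
  · intro x hx
    exact exists_algebraMap_eq_of_fixed hE ht σ h1 (hx σ rfl)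

/-! ### Splitting E(t) into polynomials and proper fractions. -/

section PolynomialPart

omit [DiffField E] [DiffField F] [DiffExtension E F]

variable (E t) in
/-- The quotients of polynomials in `t` with numerator of smaller degree. -/
def IsProper (x : F) : Prop :=
  ∃ r s : E[X], s ≠ 0 ∧ r.degree < s.degree ∧ x = aeval t r / aeval t s

theorem degree_mul_lt_mul {r s q : E[X]} (h : r.degree < s.degree) (hq : q ≠ 0) :
    (r * q).degree < (s * q).degree := by
  rw [degree_mul, degree_mul]
  exact WithBot.add_lt_add_right (degree_ne_bot.mpr hq) h

theorem IsProper.add (ht : Transcendental E t) {x y : F} (hx : IsProper E t x)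
    (hy : IsProper E t y) : IsProper E t (x + y) := by
  obtain ⟨r, s, hs, h, rfl⟩ := hx
  obtain ⟨r', s', hs', h', rfl⟩ := hy
  have hst := aeval_ne_zero_of_transcendental ht hs
  have hst' := aeval_ne_zero_of_transcendental ht hs'
  refine ⟨r * s' + s * r', s * s', mul_ne_zero hs hs', ?_, ?_⟩
  · refine (degree_add_le _ _).trans_lt (max_lt (degree_mul_lt_mul h hs') ?_)
    rw [mul_comm s, mul_comm s]
    exact degree_mul_lt_mul h' hs
  · rw [div_add_div _ _ hst hst']
    simp

theorem IsProper.smul {x : F} (hx : IsProper E t x) (a : E) : IsProper E t (a • x) := by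
  obtain ⟨r, s, hs, h, rfl⟩ := hx
  refine ⟨C a * r, s, hs, ?_, ?_⟩
  · rw [C_mul']
    exact (degree_smul_le a r).trans_lt h
  · rw [map_mul, aeval_C, Algebra.smul_def, mul_div_assoc]

theorem IsProper.sub (ht : Transcendental E t) {x y : F} (hx : IsProper E t x)
    (hy : IsProper E t y) : IsProper E t (x - y) := by
  have := hx.add ht (hy.smul (-1))
  rwa [neg_one_smul, ← sub_eq_add_neg] at this

theorem IsProper.eq_zero (ht : Transcendental E t) {p : E[X]} (hp : IsProper E t (aeval t p)) :
    p = 0 := by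
  obtain ⟨r, s, hs, h, h'⟩ := hp
  rw [eq_div_iff (aeval_ne_zero_of_transcendental ht hs), ← map_mul, ← sub_eq_zero,
    ← map_sub] at h'
  have h2 : p * s = r := by
    by_contra hne
    exact aeval_ne_zero_of_transcendental ht (sub_ne_zero.mpr hne) h'
  by_contra hp0
  rw [← h2, degree_mul] at h
  have h3 : (0 : WithBot ℕ) ≤ p.degree := zero_le_degree_iff.mpr hp0
  exact absurd h (not_lt.mpr (le_add_of_nonneg_left h3))

theorem exists_isProper_sub (hE : E⟮t⟯ = ⊤) (ht : Transcendental E t) (x : F) :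
    ∃ p : E[X], IsProper E t (x - aeval t p) := by
  obtain ⟨r, s, hs, rfl⟩ := exists_eq_div hE x
  refine ⟨r / s, r % s, s, hs, EuclideanDomain.mod_lt r hs, ?_⟩
  have hst := aeval_ne_zero_of_transcendental ht hs
  have h := congrArg (aeval t) (EuclideanDomain.div_add_mod r s)
  rw [map_add, map_mul] at h
  rw [eq_div_iff hst, sub_mul, div_mul_cancel₀ _ hst]
  linear_combination -h

theorem isProper_unique (ht : Transcendental E t) {x : F} {p q : E[X]}
    (hp : IsProper E t (x - aeval t p)) (hq : IsProper E t (x - aeval t q)) : p = q := by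
  have := hp.sub ht hq
  rw [sub_sub_sub_cancel_left, ← map_sub] at this
  exact (sub_eq_zero.mp (this.eq_zero ht)).symm

/-- The polynomial part of an element of `E(t)`. -/
theorem exists_polynomialPart (hE : E⟮t⟯ = ⊤) (ht : Transcendental E t) :
    ∃ π : F →ₗ[E] E[X], ∀ x, IsProper E t (x - aeval t (π x)) := by
  choose π hπ using exists_isProper_sub hE ht
  refine ⟨{ toFun := π, map_add' := fun x y => ?_, map_smul' := fun a x => ?_ }, hπ⟩
  · refine isProper_unique ht (hπ (x + y)) ?_
    have := (hπ x).add ht (hπ y)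
    rwa [← add_sub_add_comm, ← map_add] at this
  · refine isProper_unique ht (hπ (a • x)) ?_
    have := (hπ x).smul a
    rwa [smul_sub, ← map_smul] at this

variable [DiffField E] [DiffField F] [DiffExtension E F]

/-- The bound on `v` is what exponentials and primitives provide: differentiation then does not
raise the degree of a polynomial in `t`, so the quotient rule keeps the numerator below the squared
denominator. Hence differentiation respects the splitting. -/
theorem IsProper.partialD (ht : Transcendental E t) {i : Fin 3} {v : E[X]}
    (hv : partialD i t = aeval t v) (hdeg : v.degree ≤ 1) {x : F} (hx : IsProper E t x) :
    IsProper E t (partialD i x) := by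
  obtain ⟨r, s, hs, h, rfl⟩ := hx
  have hst := aeval_ne_zero_of_transcendental ht hs
  have hD : ∀ p : E[X], (coeffD i p + derivative p * v).degree ≤ p.degree := by
    intro p
    refine (degree_add_le _ _).trans (max_le (degree_coeffD_le i p) ?_)
    by_cases h0 : derivative p = 0
    · simp [h0]
    have hp : p ≠ 0 := by
      rintro rfl
      simp at h0
    have h1 : (derivative p).degree + 1 ≤ p.degree := by
      rw [degree_eq_natDegree h0, degree_eq_natDegree hp]
      have h2 : p.natDegree ≠ 0 := fun h2 => h0 (derivative_of_natDegree_zero h2)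
      have h3 := natDegree_derivative_lt h2
      exact_mod_cast h3
    rw [degree_mul]
    exact (add_le_add le_rfl hdeg).trans h1
  have hD' : ∀ p : E[X], DiffField.partialD i (aeval t p) =
      aeval t (coeffD i p + derivative p * v) := fun p => by
    rw [partialD_aeval, hv, map_add, map_mul]
  refine ⟨(coeffD i r + derivative r * v) * s - (coeffD i s + derivative s * v) * r, s * s,
    mul_ne_zero hs hs, ?_, ?_⟩
  · refine (degree_sub_le _ _).trans_lt (max_lt ?_ ?_)
    · exact degree_mul_lt_mul ((hD r).trans_lt h) hs
    · rw [degree_mul, degree_mul]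
      calc _ ≤ s.degree + r.degree := add_le_add (hD s) le_rfl
        _ < _ := WithBot.add_lt_add_left (degree_ne_bot.mpr hs) h
  · rw [partialD_div _ _ _ hst, hD', hD', map_sub, map_mul, map_mul, map_mul]
    ring

theorem polynomialPart_partialD (ht : Transcendental E t) {π : F →ₗ[E] E[X]}
    (hπ : ∀ x, IsProper E t (x - aeval t (π x))) {i : Fin 3} {v : E[X]}
    (hv : partialD i t = aeval t v) (hdeg : v.degree ≤ 1) (x : F) :
    π (partialD i x) = coeffD i (π x) + derivative (π x) * v := by
  refine isProper_unique ht (hπ _) ?_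
  have := (hπ x).partialD ht hv hdeg
  rwa [map_sub, partialD_aeval, hv, ← map_mul, ← map_add] at this

omit [DiffField E] [DiffField F] [DiffExtension E F] in
theorem polynomialPart_algebraMap (ht : Transcendental E t) {π : F →ₗ[E] E[X]}
    (hπ : ∀ x, IsProper E t (x - aeval t (π x))) (a : E) : π (algebraMap E F a) = C a := by
  refine isProper_unique ht (hπ _) ?_
  rw [aeval_C, sub_self]
  exact ⟨0, 1, one_ne_zero, by simp, by simp⟩

end PolynomialPart

/-- If ∂t = ηt, each power of `t` is differentiated into an `E`-multiple of itself, so the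
coefficient of t⁰ in the polynomial part commutes with the derivations. -/
theorem HasClosedMultiplierIn.of_exponential {Ω : TwoForm E} (hE : E⟮t⟯ = ⊤)
    (ht : Transcendental E t) {η : Fin 3 → E}
    (hη : ∀ i, partialD i t = algebraMap E F (η i) * t) (h : HasClosedMultiplierIn F Ω) :
    HasClosedMultiplier Ω := by
  obtain ⟨π, hπ⟩ := exists_polynomialPart hE ht
  refine h.of_retraction ((lcoeff E 0).comp π) ?_ ?_
  · have := polynomialPart_algebraMap ht hπ 1
    rw [map_one] at this
    simp [this]
  · intro i x
    have := polynomialPart_partialD ht hπ (i := i) (v := C (η i) * X) (by simp [hη])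
      (degree_C_mul_X_le _) x
    rw [LinearMap.comp_apply, LinearMap.comp_apply, this, lcoeff_apply, lcoeff_apply, coeff_add,
      coeff_coeffD, ← mul_assoc, mul_coeff_zero, coeff_X_zero, mul_zero, add_zero]

/-- In the primitive case the leading coefficient of a non-constant polynomial part is closed. -/
theorem exists_closed_of_primitive (ht : Transcendental E t) {π : F →ₗ[E] E[X]}
    (hπ : ∀ x, IsProper E t (x - aeval t (π x))) {η : Fin 3 → E}
    (hη : ∀ i, partialD i t = algebraMap E F (η i)) {b : OneForm F} (hb : dOne b = 0) :
    (∃ n, n ≠ 0 ∧ (fun i => (π (b i)).coeff n) ≠ 0 ∧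
      dOne (fun i => (π (b i)).coeff n) = 0) ∨
    dOne (fun i => (π (b i)).coeff 0) = 0 := by
  rw [dOne_eq_zero_iff] at hb
  have hd : ∀ i j n, partialD i ((π (b j)).coeff n) + (π (b j)).coeff (n + 1) * (n + 1) * η i =
      partialD j ((π (b i)).coeff n) + (π (b i)).coeff (n + 1) * (n + 1) * η j := by
    intro i j n
    have hv : ∀ i, partialD i t = aeval t (C (η i)) := fun i => by rw [hη, aeval_C]
    have hdeg : ∀ i, (C (η i)).degree ≤ 1 := fun i => degree_C_le.trans zero_le_one
    have := congrArg (fun x => (π x).coeff n) (hb i j)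
    simpa only [polynomialPart_partialD ht hπ (hv i) (hdeg i),
      polynomialPart_partialD ht hπ (hv j) (hdeg j), coeff_add, coeff_mul_C, coeff_coeffD,
      coeff_derivative] using this
  -- In top degree the terms coming from ∂t, which involve the coefficients of degree `N + 1`, drop
  -- out of `hd`.
  let N := Finset.univ.sup fun i => (π (b i)).natDegree
  have hN : ∀ i, (π (b i)).coeff (N + 1) = 0 := fun i =>
    coeff_eq_zero_of_natDegree_lt
      (Nat.lt_succ_of_le (Finset.le_sup (f := fun i => (π (b i)).natDegree) (Finset.mem_univ i)))
  have hclosed : dOne (fun i => (π (b i)).coeff N) = 0 := by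
    rw [dOne_eq_zero_iff]
    intro i j
    simpa [hN] using hd i j N
  by_cases h0 : N = 0
  · right
    rwa [h0] at hclosed
  · refine Or.inl ⟨N, h0, fun hz => ?_, hclosed⟩
    obtain ⟨i, -, hi⟩ := Finset.exists_mem_eq_sup Finset.univ ⟨0, Finset.mem_univ 0⟩
      fun i => (π (b i)).natDegree
    have h1 : (π (b i)).natDegree ≠ 0 := fun h => h0 (hi.trans h)
    have h2 : (π (b i)).coeff N = 0 := congrFun hz i
    rw [show N = _ from hi, coeff_natDegree, leadingCoeff_eq_zero] at h2
    exact h1 (by rw [h2, natDegree_zero])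

/-- Here t¹ contributes to the derivative of t⁰, so taking constant terms need not commute with
derivations. If some polynomial part has positive degree, its top coefficients give a closed form;
as ω and Ω are over `E`, the multiplier identity has nothing else in that degree, and Ω annihilates
this form. -/
theorem HasClosedMultiplierIn.of_primitive {Ω : TwoForm E} (hE : E⟮t⟯ = ⊤)
    (ht : Transcendental E t) {η : Fin 3 → E}
    (hη : ∀ i, partialD i t = algebraMap E F (η i)) (h : HasClosedMultiplierIn F Ω) :
    HasClosedMultiplier Ω := by
  obtain ⟨π, hπ⟩ := exists_polynomialPart hE ht
  have hr : ∀ (x : F) (a : E), π (x * algebraMap E F a) = C a * π x := fun x a => by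
    rw [mul_comm, ← Algebra.smul_def, map_smul, smul_eq_C_mul]
  have hr' : ∀ (x : F) (a : E), π (algebraMap E F a * x) = C a * π x := fun x a => by
    rw [mul_comm, hr]
  have hC := polynomialPart_algebraMap ht hπ
  rcases h with ⟨w, a, hw, h1, h2, h3⟩ | ⟨b, h1, h2⟩
  · have hcoeff : ∀ i j n, (C (partialD i (w j) - partialD j (w i))).coeff n =
        (π (a i)).coeff n * w j - (π (a j)).coeff n * w i := by
      intro i j n
      rw [wedgeOneOne_eq_dOne_iff] at h2
      have := congrArg (fun x => (π x).coeff n) (h2 i j)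
      simpa only [formMap, partialD_algebraMap, map_sub, coeff_sub, hr, hC, coeff_C_mul,
        mul_comm] using this
    rcases exists_closed_of_primitive ht hπ hη h3 with ⟨n, hn, hne, hcl⟩ | hcl
    · refine hasClosedMultiplier_of_closed hne ?_ hcl
      obtain ⟨j, hj⟩ := Function.ne_iff.mp hw
      rw [Pi.zero_apply] at hj
      -- dω has no tⁿ term for n > 0, so the tⁿ-coefficient of α is proportional to ω and inherits
      -- its annihilation by Ω.
      have hp : ∀ i, (π (a i)).coeff n * w j = (π (a j)).coeff n * w i := fun i => by
        have := hcoeff i j n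
        rw [coeff_C_of_ne_zero hn] at this
        linear_combination -this
      have : wedgeOneTwo (fun i => (π (a i)).coeff n) Ω * w j = 0 := by
        simp only [wedgeOneTwo] at h1 ⊢
        linear_combination Ω 0 * hp 0 + Ω 1 * hp 1 + Ω 2 * hp 2 + (π (a j)).coeff n * h1
      exact (mul_eq_zero.mp this).resolve_right hj
    · refine Or.inl ⟨w, _, hw, h1, ?_, hcl⟩
      rw [wedgeOneOne_eq_dOne_iff]
      intro i j
      have := hcoeff i j 0
      rwa [coeff_C_zero] at this
  · have hcoeff : ∀ n, (C (dTwo Ω)).coeff n = wedgeOneTwo (fun i => (π (b i)).coeff n) Ω := by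
      intro n
      rw [dTwo_formMap] at h1
      have := congrArg (fun x => (π x).coeff n) h1
      simpa only [wedgeOneTwo, formMap, map_add, coeff_add, hr, hC, coeff_C_mul,
        mul_comm] using this
    rcases exists_closed_of_primitive ht hπ hη h2 with ⟨n, hn, hne, hcl⟩ | hcl
    · refine hasClosedMultiplier_of_closed hne ?_ hcl
      rw [← hcoeff, coeff_C_of_ne_zero hn]
    · refine Or.inr ⟨_, ?_, hcl⟩
      rw [← hcoeff, coeff_C_zero]

theorem HasClosedMultiplier.of_step [CharZero E] {Ω : TwoForm E} (hE : E⟮t⟯ = ⊤)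
    (hstep : (∃ η : Fin 3 → E, ∀ i, partialD i t = algebraMap E F (η i) * t) ∨
      (∃ η : Fin 3 → E, ∀ i, partialD i t = algebraMap E F (η i)) ∨ IsAlgebraic E t)
    (h : HasClosedMultiplier (_root_.formMap F Ω)) : HasClosedMultiplier Ω := by
  have : CharZero F := charZero_of_injective_algebraMap (algebraMap E F).injective
  -- An exponential or a primitive may be algebraic; disposing of this case first leaves `t`
  -- transcendental.
  by_cases halg : IsAlgebraic E t
  · have : FiniteDimensional E E⟮t⟯ := adjoin.finiteDimensional halg.isIntegral
    have : FiniteDimensional E F := by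
      rw [hE] at this
      exact topEquiv.toLinearEquiv.finiteDimensional
    exact h.of_finiteDimensional
  rcases hstep with ⟨η, hη⟩ | ⟨η, hη⟩ | h'
  -- An exponential is determined up to a constant factor: 2t satisfies the same equation, and the
  -- orbit 2ⁿt is infinite in characteristic zero.
  · refine (h.in_of_substitution hE halg (u := algebraMap E F 2 * t) ?_ ?_).of_exponential hE
      halg hη
    · intro hu
      refine halg ?_
      have h2 : IsAlgebraic E (algebraMap E F 2⁻¹ * (algebraMap E F 2 * t)) :=
        (isAlgebraic_algebraMap _).mul hu
      rwa [← mul_assoc, ← map_mul, inv_mul_cancel₀ two_ne_zero, map_one, one_mul] at h2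
    · intro σ hσ
      have ht0 : t ≠ 0 := fun h0 => halg (h0 ▸ isAlgebraic_zero)
      have hit : ∀ n : ℕ, (σ^[n]) t = 2 ^ n * t := by
        intro n
        induction n with
        | zero => simp
        | succ n ih =>
          rw [Function.iterate_succ_apply', ih, map_mul, map_pow, hσ, map_ofNat, map_ofNat]
          ring
      refine ⟨fun m n hmn => ?_, fun i => ?_⟩
      · have hmn' : (σ^[m]) t = (σ^[n]) t := hmn
        rw [hit, hit] at hmn'
        have := mul_right_cancel₀ ht0 hmn'
        have : (2 : ℕ) ^ m = 2 ^ n := by exact_mod_cast this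
        exact Nat.pow_right_injective le_rfl this
      · rw [hη, map_mul, hσ, AlgHom.commutes, Derivation.leibniz, hη, partialD_algebraMap]
        have h2 : partialD i (2 : E) = 0 := by
          exact_mod_cast (partialD (L := E) i).map_natCast 2
        simp [h2]
        ring
  -- A primitive is determined up to an additive constant; the orbit is t + n.
  · refine (h.in_of_substitution hE halg (u := t + 1) ?_ ?_).of_primitive hE halg hη
    · intro hu
      refine halg ?_
      have h2 : IsAlgebraic E (t + 1 - 1) := hu.sub isAlgebraic_one
      rwa [add_sub_cancel_right] at h2
    · intro σ hσ
      have hit : ∀ n : ℕ, (σ^[n]) t = t + n := by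
        intro n
        induction n with
        | zero => simp
        | succ n ih =>
          rw [Function.iterate_succ_apply', ih, map_add, map_natCast, hσ]
          push_cast
          ring
      refine ⟨fun m n hmn => ?_, fun i => ?_⟩
      · have hmn' : (σ^[m]) t = (σ^[n]) t := hmn
        rw [hit, hit] at hmn'
        exact_mod_cast add_left_cancel hmn'
      · rw [hη, AlgHom.commutes, hσ, map_add, hη, Derivation.map_one_eq_zero, add_zero]
  · exact absurd h' halg

end Transcendental

end LiouvillianForms

namespace LiouvillianForms

open DiffField Polynomial IntermediateField

/-! ### Descent along the whole tower. -/

section Tower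

variable {K : Type u} {L : Type v} [Field K] [Field L] [DiffField L] [Algebra K L]

/-- Closure of an intermediate field under the derivations. -/
def IsDiffClosed (E : IntermediateField K L) : Prop :=
  ∀ i : Fin 3, ∀ a ∈ E, partialD i a ∈ E

/-- The derivations of an intermediate field which is closed under them. -/
@[reducible]
def IsDiffClosed.diffField {E : IntermediateField K L} (hE : IsDiffClosed E) : DiffField E where
  partialD i := Derivation.mk'
    { toFun := fun a => ⟨partialD i (a : L), hE i a a.2⟩
      map_add' := fun a b => Subtype.ext (map_add (partialD i) (a : L) b)
      map_smul' := fun n a => Subtype.ext (map_zsmul (partialD i) n (a : L)) }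
    fun a b => Subtype.ext ((partialD i).leibniz (a : L) b)
  comm i j a := Subtype.ext (comm i j (a : L))

theorem IsDiffClosed.diffExtension_left [DiffField K] [DiffExtension K L]
    {E : IntermediateField K L} (hE : IsDiffClosed E) :
    @DiffExtension K E _ _ _ hE.diffField _ :=
  @DiffExtension.mk _ _ _ _ _ hE.diffField _ fun i a =>
    Subtype.ext (partialD_algebraMap (F := L) i a)

theorem IsDiffClosed.diffExtension_right {E : IntermediateField K L} (hE : IsDiffClosed E) :
    @DiffExtension E L _ _ hE.diffField _ _ :=
  @DiffExtension.mk _ _ _ _ hE.diffField _ _ fun _ _ => rfl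

theorem isDiffClosed_bot [DiffField K] [DiffExtension K L] :
    IsDiffClosed (⊥ : IntermediateField K L) := by
  intro i a ha
  obtain ⟨b, rfl⟩ := mem_bot.mp ha
  rw [partialD_algebraMap]
  exact IntermediateField.algebraMap_mem _ _

theorem aeval_mem_adjoin_simple {K : Type u} {L : Type v} [Field K] [Field L] [Algebra K L] (t : L)
    (p : K[X]) : aeval t p ∈ K⟮t⟯ :=
  (mem_adjoin_simple_iff K _).mpr ⟨p, 1, by simp⟩

theorem isDiffClosed_adjoin_simple [DiffField K] [DiffExtension K L] {t : L}
    (ht : ∀ i, partialD i t ∈ K⟮t⟯) : IsDiffClosed K⟮t⟯ := by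
  have hmem := aeval_mem_adjoin_simple (K := K) t
  have hp : ∀ i (p : K[X]), partialD i (aeval t p) ∈ K⟮t⟯ := fun i p => by
    rw [partialD_aeval]
    exact add_mem (hmem _) (mul_mem (hmem _) (ht i))
  intro i a ha
  obtain ⟨r, s, rfl⟩ := (mem_adjoin_simple_iff K a).mp ha
  by_cases hs : aeval t s = 0
  · rw [hs, div_zero, map_zero]
    exact zero_mem _
  · rw [partialD_div _ _ _ hs]
    exact div_mem (sub_mem (mul_mem (hp i r) (hmem s)) (mul_mem (hmem r) (hp i s)))
      (pow_mem (hmem s) 2)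

/-- Differentiating the minimal polynomial at `t` can be solved for ∂t, its derivative at `t` being
nonzero by separability. -/
theorem partialD_mem_adjoin_of_isAlgebraic [DiffField K] [DiffExtension K L] [CharZero K] {t : L}
    (ht : IsAlgebraic K t) (i : Fin 3) : partialD i t ∈ K⟮t⟯ := by
  have h := partialD_aeval i t (minpoly K t)
  rw [minpoly.aeval, map_zero] at h
  have hsep := (minpoly.irreducible ht.isIntegral).separable.aeval_derivative_ne_zero
    (minpoly.aeval K t)
  have : partialD i t = -(aeval t (coeffD i (minpoly K t))) /
      aeval t (derivative (minpoly K t)) := by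
    rw [eq_div_iff hsep]
    linear_combination -h
  rw [this]
  exact div_mem (neg_mem (aeval_mem_adjoin_simple t _)) (aeval_mem_adjoin_simple t _)

/-- A closed multiplier with all coefficients in a subset of the field. -/
def HasClosedMultiplierOn (S : Set L) (Ω : TwoForm L) : Prop :=
  (∃ ω α : OneForm L, (∀ i, ω i ∈ S) ∧ (∀ i, α i ∈ S) ∧ ω ≠ 0 ∧ wedgeOneTwo ω Ω = 0 ∧
    wedgeOneOne α ω = dOne ω ∧ dOne α = 0) ∨
    ∃ β : OneForm L, (∀ i, β i ∈ S) ∧ dTwo Ω = wedgeOneTwo β Ω ∧ dOne β = 0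

/-- Permits the descent to take place inside the fixed field `L`, so that the intermediate fields
need derivations only one step at a time. -/
theorem hasClosedMultiplierOn_range_iff [DiffField K] [DiffExtension K L] {Ω : TwoForm K} :
    HasClosedMultiplierOn (Set.range (algebraMap K L)) (formMap L Ω) ↔
      HasClosedMultiplier Ω := by
  constructor
  · rintro (⟨w, a, hw, ha, h0, h1, h2, h3⟩ | ⟨b, hb, h1, h2⟩)
    · choose w' hw' using hw
      choose a' ha' using ha
      obtain rfl : formMap L w' = w := funext hw'
      obtain rfl : formMap L a' = a := funext ha'
      refine Or.inl ⟨w', a', ?_, ?_, ?_, ?_⟩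
      · rintro rfl
        exact h0 (formMap_zero (E := K) (F := L))
      · rw [wedgeOneTwo_formMap] at h1
        simpa using h1
      · rw [wedgeOneOne_formMap, dOne_formMap] at h2
        exact formMap_injective h2
      · rw [dOne_formMap, ← formMap_zero (E := K)] at h3
        exact formMap_injective h3
    · choose b' hb' using hb
      obtain rfl : formMap L b' = b := funext hb'
      refine Or.inr ⟨b', ?_, ?_⟩
      · rw [wedgeOneTwo_formMap, dTwo_formMap] at h1
        exact (algebraMap K L).injective h1
      · rw [dOne_formMap, ← formMap_zero (E := K)] at h2
        exact formMap_injective h2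
  · rintro (⟨w, a, h0, h1, h2, h3⟩ | ⟨b, h1, h2⟩)
    · refine Or.inl ⟨formMap L w, formMap L a, fun i => ⟨_, rfl⟩, fun i => ⟨_, rfl⟩, fun h => ?_,
        ?_, ?_, ?_⟩
      · exact h0 (formMap_injective (h.trans formMap_zero.symm))
      · rw [wedgeOneTwo_formMap, h1, map_zero]
      · rw [wedgeOneOne_formMap, h2, dOne_formMap]
      · rw [dOne_formMap, h3, formMap_zero]
    · refine Or.inr ⟨formMap L b, fun i => ⟨_, rfl⟩, ?_, ?_⟩
      · rw [dTwo_formMap, h1, wedgeOneTwo_formMap]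
      · rw [dOne_formMap, h2, formMap_zero]

theorem partialD_mem_adjoin_of_step [DiffField K] [DiffExtension K L] [CharZero K] {t : L}
    (h : (∃ η : Fin 3 → K, ∀ i, partialD i t = algebraMap K L (η i) * t) ∨
      (∃ η : Fin 3 → K, ∀ i, partialD i t = algebraMap K L (η i)) ∨ IsAlgebraic K t) (i : Fin 3) :
    partialD i t ∈ K⟮t⟯ := by
  rcases h with ⟨η, hη⟩ | ⟨η, hη⟩ | h
  · rw [hη]
    exact mul_mem (IntermediateField.algebraMap_mem _ _) (mem_adjoin_simple_self K t)
  · rw [hη]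
    exact IntermediateField.algebraMap_mem _ _
  · exact partialD_mem_adjoin_of_isAlgebraic h i

/-- Descent along one generator, with the coefficients viewed in the top field. -/
theorem hasClosedMultiplierOn_adjoin_simple [DiffField K] [DiffExtension K L] [CharZero K] {t : L}
    (hstep : (∃ η : Fin 3 → K, ∀ i, partialD i t = algebraMap K L (η i) * t) ∨
      (∃ η : Fin 3 → K, ∀ i, partialD i t = algebraMap K L (η i)) ∨ IsAlgebraic K t)
    {Ω : TwoForm K} (h : HasClosedMultiplierOn (K⟮t⟯ : Set L) (formMap L Ω)) :
    HasClosedMultiplier Ω := by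
  have hcl := isDiffClosed_adjoin_simple (partialD_mem_adjoin_of_step hstep)
  let := hcl.diffField
  have := hcl.diffExtension_left
  have := hcl.diffExtension_right
  have hr : Set.range (algebraMap K⟮t⟯ L) = (K⟮t⟯ : Set L) := Subtype.range_coe
  have hmap : formMap L (formMap K⟮t⟯ Ω) = formMap L Ω := rfl
  rw [← hr, ← hmap, hasClosedMultiplierOn_range_iff] at h
  refine h.of_step (t := AdjoinSimple.gen K t) ?_ ?_
  · apply lift_injective
    rw [lift_adjoin_simple, lift_top]
    rfl
  · refine hstep.imp ?_ (Or.imp ?_ fun halg => ?_)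
    · rintro ⟨η, hη⟩
      exact ⟨η, fun i => Subtype.ext (hη i)⟩
    · rintro ⟨η, hη⟩
      exact ⟨η, fun i => Subtype.ext (hη i)⟩
    · exact (isAlgebraic_algebraMap_iff (algebraMap K⟮t⟯ L).injective).mp halg

/-- Descent along one step of a Liouvillian tower; the larger field is again differential. -/
theorem LiouvillianStep.descent [DiffField K] [DiffExtension K L] [CharZero K]
    {E E' : IntermediateField K L} (hE : IsDiffClosed E) (h : LiouvillianStep K L E E') :
    IsDiffClosed E' ∧ ∀ Ω : TwoForm K, HasClosedMultiplierOn (E' : Set L) (formMap L Ω) →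
      HasClosedMultiplierOn (E : Set L) (formMap L Ω) := by
  obtain ⟨t, rfl, h⟩ := h
  let := hE.diffField
  have := hE.diffExtension_left
  have := hE.diffExtension_right
  have : CharZero E := charZero_of_injective_algebraMap (algebraMap K E).injective
  have hstep : (∃ η : Fin 3 → E, ∀ i, partialD i t = algebraMap E L (η i) * t) ∨
      (∃ η : Fin 3 → E, ∀ i, partialD i t = algebraMap E L (η i)) ∨ IsAlgebraic E t := by
    refine h.imp ?_ (Or.imp_left ?_)
    · rintro ⟨ht, hη⟩
      exact ⟨fun i => ⟨_, hη i⟩, fun i => (div_mul_cancel₀ _ ht).symm⟩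
    · exact fun hη => ⟨fun i => ⟨_, hη i⟩, fun i => rfl⟩
  rw [← restrictScalars_adjoin_eq_sup]
  have hcl : IsDiffClosed E⟮t⟯ := isDiffClosed_adjoin_simple (partialD_mem_adjoin_of_step hstep)
  refine ⟨fun i a ha => hcl i a ha, fun Ω hΩ => ?_⟩
  have hr : Set.range (algebraMap E L) = (E : Set L) := Subtype.range_coe
  have hmap : formMap L (formMap E Ω) = formMap L Ω := rfl
  rw [← hmap] at hΩ ⊢
  rw [← hr, hasClosedMultiplierOn_range_iff]
  exact hasClosedMultiplierOn_adjoin_simple hstep hΩ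

theorem hasClosedMultiplier_of_tower [DiffField K] [DiffExtension K L] [CharZero K] {m : ℕ}
    {E : ℕ → IntermediateField K L} (h0 : E 0 = ⊥) (hm : E m = ⊤)
    (hstep : ∀ i < m, LiouvillianStep K L (E i) (E (i + 1))) {Ω : TwoForm K}
    (h : HasClosedMultiplier (formMap L Ω)) : HasClosedMultiplier Ω := by
  -- Closure under the derivations is carried up the tower; multipliers are then carried down.
  have hcl : ∀ i ≤ m, IsDiffClosed (E i) := by
    intro i
    induction i with
    | zero => exact fun _ => h0 ▸ isDiffClosed_bot
    | succ i ih => exact fun hi => (LiouvillianStep.descent (ih (by omega)) (hstep i hi)).1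
  have hdesc : ∀ i ≤ m, HasClosedMultiplierOn (E i : Set L) (formMap L Ω) →
      HasClosedMultiplierOn (E 0 : Set L) (formMap L Ω) := by
    intro i
    induction i with
    | zero => exact fun _ => id
    | succ i ih =>
      exact fun hi h' => ih (by omega)
        ((LiouvillianStep.descent (hcl i (by omega)) (hstep i hi)).2 Ω h')
  have htop : HasClosedMultiplierOn (E m : Set L) (formMap L Ω) := by
    rw [hm]
    rcases h with ⟨w, a, h0, h1, h2, h3⟩ | ⟨b, h1, h2⟩
    · exact Or.inl ⟨w, a, fun _ => mem_top, fun _ => mem_top, h0, h1, h2, h3⟩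
    · exact Or.inr ⟨b, fun _ => mem_top, h1, h2⟩
  have hbot := hdesc m le_rfl htop
  rw [h0, coe_bot] at hbot
  exact hasClosedMultiplierOn_range_iff.mp hbot

end Tower

end LiouvillianForms

namespace LiouvillianForms

open DiffField

/-! ### Formal power series: constants, integration, exponentials. -/

section PowerSeries

open MvPowerSeries Finset

/-- Formal power series in three variables. -/
abbrev Series3 : Type := MvPowerSeries (Fin 3) ℂ

theorem pderiv_pderiv_comm (i j : Fin 3) (f : Series3) :
    pderiv ℂ i (pderiv ℂ j f) = pderiv ℂ j (pderiv ℂ i f) := by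
  rcases eq_or_ne i j with rfl | hij
  · rfl
  ext n
  simp only [coeff_pderiv, Finsupp.add_apply, Finsupp.single_eq_of_ne hij,
    Finsupp.single_eq_of_ne hij.symm, add_right_comm n (Finsupp.single i 1)]
  push_cast
  ring

theorem coeff_X_mul_pderiv (i : Fin 3) (f : Series3) (n : Fin 3 →₀ ℕ) :
    coeff n (X i * pderiv ℂ i f) = n i * coeff n f := by
  rw [X, coeff_monomial_mul, one_mul]
  split_ifs with hn
  · rw [Finsupp.single_le_iff] at hn
    rw [coeff_pderiv, tsub_add_cancel_of_le (Finsupp.single_le_iff.mpr hn), mul_comm,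
      Finsupp.tsub_apply, Finsupp.single_eq_same, Nat.cast_sub hn, Nat.cast_one, sub_add_cancel]
  · rw [Finsupp.single_le_iff, not_le, Nat.lt_one_iff] at hn
    rw [hn, Nat.cast_zero, zero_mul]

/-- Lexicographically lowest terms multiply: any other splitting of `p + q` has one part below `p`
or `q`. -/
theorem coeff_add_mul_of_lex {f g : Series3} {p q : Fin 3 →₀ ℕ}
    (hp : ∀ d, toLex d < toLex p → coeff d f = 0) (hq : ∀ d, toLex d < toLex q → coeff d g = 0) :
    coeff (p + q) (f * g) = coeff p f * coeff q g := by
  rw [coeff_mul, Finset.sum_eq_single_of_mem ⟨p, q⟩ (by simp)]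
  rintro ⟨a, b⟩ h h'
  rw [Finset.HasAntidiagonal.mem_antidiagonal] at h
  rcases trichotomy_of_add_eq_add (congrArg toLex h) with h'' | h'' | h''
  · exact absurd (by rw [Prod.mk.injEq]; exact h'') h'
  · rw [hp _ h'', zero_mul]
  · rw [hq _ h'', mul_zero]

/-- The Euler operators xᵢ∂ᵢ are diagonal on monomials. Comparing lowest terms of (xᵢ∂ᵢf) g = f
(xᵢ∂ᵢg) gives pᵢ = qᵢ for the lowest exponents. -/
theorem lexOrder_eq_of_wronskian {f g : Series3} (hf : f ≠ 0) (hg : g ≠ 0)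
    (h : ∀ i, pderiv ℂ i f * g = f * pderiv ℂ i g) : lexOrder f = lexOrder g := by
  obtain ⟨p, hp⟩ := exists_finsupp_eq_lexOrder_of_ne_zero hf
  obtain ⟨q, hq⟩ := exists_finsupp_eq_lexOrder_of_ne_zero hg
  have hfp := coeff_ne_zero_of_lexOrder hp.symm
  have hgq := coeff_ne_zero_of_lexOrder hq.symm
  have hf' : ∀ d, toLex d < toLex p → coeff d f = 0 := fun d hd =>
    coeff_eq_zero_of_lt_lexOrder (by rw [hp]; exact_mod_cast hd)
  have hg' : ∀ d, toLex d < toLex q → coeff d g = 0 := fun d hd =>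
    coeff_eq_zero_of_lt_lexOrder (by rw [hq]; exact_mod_cast hd)
  suffices p = q by rw [hp, hq, this]
  ext i
  have h1 : (X i * pderiv ℂ i f) * g = f * (X i * pderiv ℂ i g) := by
    linear_combination (X i : Series3) * h i
  have h2 := congrArg (coeff (p + q)) h1
  rw [coeff_add_mul_of_lex (fun d hd => by rw [coeff_X_mul_pderiv, hf' d hd, mul_zero]) hg',
    coeff_add_mul_of_lex hf' (fun d hd => by rw [coeff_X_mul_pderiv, hg' d hd, mul_zero]),
    coeff_X_mul_pderiv, coeff_X_mul_pderiv] at h2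
  have h3 : ((p i : ℂ) - q i) * (coeff p f * coeff q g) = 0 := by linear_combination h2
  have h4 := (mul_eq_zero.mp h3).resolve_right (mul_ne_zero hfp hgq)
  exact_mod_cast sub_eq_zero.mp h4

/-- Choose `c` to cancel the coefficient of `f` at the lowest exponent of `g`. If f − cg were
nonzero, it would satisfy the same relation and have that very lowest exponent. -/
theorem exists_eq_C_mul_of_wronskian {f g : Series3} (hg : g ≠ 0)
    (h : ∀ i, pderiv ℂ i f * g = f * pderiv ℂ i g) : ∃ c : ℂ, f = C c * g := by
  obtain ⟨q, hq⟩ := exists_finsupp_eq_lexOrder_of_ne_zero hg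
  have hgq := coeff_ne_zero_of_lexOrder hq.symm
  refine ⟨coeff q f / coeff q g, ?_⟩
  by_contra hne
  have hne' := sub_ne_zero.mpr hne
  have ho := lexOrder_eq_of_wronskian hne' hg fun i => by
    rw [map_sub, Derivation.leibniz, pderiv_C, smul_zero, add_zero, smul_eq_mul]
    linear_combination h i
  refine coeff_ne_zero_of_lexOrder (ho.trans hq).symm ?_
  rw [map_sub, coeff_C_mul, div_mul_cancel₀ _ hgq, sub_self]

/-- The formal Poincaré lemma for 1-forms. -/
theorem exists_pderiv_eq {a : Fin 3 → Series3}
    (h : ∀ i j, pderiv ℂ i (a j) = pderiv ℂ j (a i)) :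
    ∃ f : Series3, constantCoeff f = 0 ∧ ∀ i, pderiv ℂ i f = a i := by
  classical
  -- Each variable occurring in the monomial prescribes its coefficient in the integral; closedness
  -- says that the prescriptions agree.
  have key : ∀ (m : Fin 3 →₀ ℕ) (i j : Fin 3), m i ≠ 0 → m j ≠ 0 →
      coeff (m - Finsupp.single i 1) (a i) / m i = coeff (m - Finsupp.single j 1) (a j) / m j := by
    intro m i j hi hj
    rcases eq_or_ne i j with rfl | hij
    · rfl
    obtain ⟨k, rfl⟩ : ∃ k, m = k + Finsupp.single i 1 + Finsupp.single j 1 := by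
      refine ⟨m - Finsupp.single i 1 - Finsupp.single j 1, ?_⟩
      ext l
      simp only [Finsupp.add_apply, Finsupp.tsub_apply, Finsupp.single_apply]
      split_ifs with h1 h2 h2
      · exact absurd (h1.trans h2.symm) hij
      · subst h1; omega
      · subst h2; omega
      · omega
    rw [add_tsub_cancel_right, add_right_comm, add_tsub_cancel_right, add_right_comm]
    have := congrArg (coeff k) (h i j)
    rw [coeff_pderiv, coeff_pderiv] at this
    simp only [Finsupp.add_apply, Finsupp.single_eq_same, Finsupp.single_eq_of_ne hij,
      Finsupp.single_eq_of_ne hij.symm, add_zero]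
    rw [div_eq_div_iff (Nat.cast_ne_zero.mpr (Nat.succ_ne_zero _))
      (Nat.cast_ne_zero.mpr (Nat.succ_ne_zero _))]
    push_cast
    exact this.symm
  let f : Series3 := fun n => if h : ∃ i, n i ≠ 0 then
    coeff (n - Finsupp.single h.choose 1) (a h.choose) / n h.choose else 0
  refine ⟨f, ?_, fun i => ?_⟩
  · rw [← coeff_zero_eq_constantCoeff_apply]
    change f 0 = 0
    simp [f]
  · ext n
    have hex : ∃ j, (n + Finsupp.single i 1 : Fin 3 →₀ ℕ) j ≠ 0 := ⟨i, by simp⟩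
    rw [coeff_pderiv]
    have h1 : coeff (n + Finsupp.single i 1) f = coeff (n + Finsupp.single i 1 -
        Finsupp.single hex.choose 1) (a hex.choose) / (n + Finsupp.single i 1 : Fin 3 →₀ ℕ) hex.choose := by
      change f _ = _
      simp only [f, dif_pos hex]
    rw [h1, key _ _ i hex.choose_spec (by simp), add_tsub_cancel_right]
    have : ((n i : ℂ) + 1) ≠ 0 := Nat.cast_add_one_ne_zero (n i)
    simp [this]

/-- The exponential of a formal power series without constant term. -/
theorem exists_exp {g : Series3} (hg : constantCoeff g = 0) :
    ∃ m : Series3, constantCoeff m = 1 ∧ ∀ i, pderiv ℂ i m = m * pderiv ℂ i g := by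
  let T : ℕ → Series3 := fun N => ∑ k ∈ range (N + 1), C ((k.factorial : ℂ)⁻¹) * g ^ k
  -- As `g` has no constant term, gᵏ has no terms of degree below `k`, so coefficients of total
  -- degree d are final from `T d` on.
  let m : Series3 := fun n => coeff n (T n.degree)
  have hm : ∀ (n : Fin 3 →₀ ℕ) (N : ℕ), n.degree ≤ N → coeff n m = coeff n (T N) := by
    intro n N hN
    induction N, hN using Nat.le_induction with
    | base => rfl
    | succ N hN ih =>
      have : T (N + 1) = T N + C (((N + 1).factorial : ℂ)⁻¹) * g ^ (N + 1) :=
        sum_range_succ _ _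
      rw [this, map_add, coeff_C_mul, coeff_eq_zero_of_constantCoeff_nilpotent (m := 1)
        (by simp [hg]) (by omega), mul_zero, add_zero, ih]
  have hT : ∀ i N, pderiv ℂ i (T (N + 1)) = T N * pderiv ℂ i g := by
    intro i N
    have h0 : T (N + 1) = _ := sum_range_succ' _ _
    rw [h0, map_add, map_sum, sum_mul]
    simp only [pow_zero, mul_one, pderiv_C, add_zero]
    refine sum_congr rfl fun k _ => ?_
    rw [Derivation.leibniz, pderiv_C, smul_zero, add_zero, pderiv_pow, smul_eq_mul,
      Nat.add_sub_cancel, ← mul_assoc, ← mul_assoc]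
    congr 2
    rw [← map_natCast (C (σ := Fin 3) (R := ℂ)) (k + 1), ← map_mul, Nat.factorial_succ]
    congr 1
    have : ((k : ℂ) + 1) ≠ 0 := Nat.cast_add_one_ne_zero k
    push_cast
    field_simp
  refine ⟨m, ?_, fun i => ?_⟩
  · rw [← coeff_zero_eq_constantCoeff_apply, hm 0 0 (by simp)]
    simp [T]
  · ext n
    have hdeg : (n + Finsupp.single i 1).degree = n.degree + 1 := by
      rw [map_add, Finsupp.degree_single]
    rw [coeff_pderiv, hm _ _ hdeg.le, ← coeff_pderiv, hT, coeff_mul, coeff_mul]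
    refine sum_congr rfl fun x hx => ?_
    rw [HasAntidiagonal.mem_antidiagonal] at hx
    rw [hm x.1 n.degree]
    rw [← hx, map_add]
    exact Nat.le_add_right _ _

end PowerSeries

end LiouvillianForms

namespace LiouvillianForms

open DiffField

/-! ### Expansion of rational functions at a point. -/

section FormalMeromorphic

instance : IsDomain Series3 := NoZeroDivisors.to_isDomain _

/-- The field of fractions of the ring of formal power series. -/
abbrev Mero3 : Type := FractionRing Series3

noncomputable instance instDiffFieldMero3 : DiffField Mero3 where
  partialD i := FracDeriv.der (MvPowerSeries.pderiv ℂ i)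
  comm i j a := FracDeriv.der_comm _ _ (pderiv_pderiv_comm i j) a

theorem partialD_series (i : Fin 3) (f : Series3) :
    partialD i (algebraMap Series3 Mero3 f) =
      algebraMap Series3 Mero3 (MvPowerSeries.pderiv ℂ i f) :=
  FracDeriv.der_algebraMap _ f

theorem partialD_poly (i : Fin 3) (p : Poly3) :
    partialD i (algebraMap Poly3 Rat3 p) = algebraMap Poly3 Rat3 (MvPolynomial.pderiv i p) :=
  FracDeriv.der_algebraMap _ p

theorem series_injective : Function.Injective (algebraMap Series3 Mero3) :=
  IsFractionRing.injective Series3 Mero3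

theorem exists_eq_C_of_isConst {a : Mero3} (ha : IsConst a) :
    ∃ c : ℂ, a = algebraMap Series3 Mero3 (MvPowerSeries.C c) := by
  obtain ⟨f, g, hg, rfl⟩ := FracDeriv.exists_div (A := Series3) a
  have hg' := FracDeriv.algebraMap_ne (F := Mero3) hg
  obtain ⟨c, rfl⟩ := exists_eq_C_mul_of_wronskian (f := f) hg fun i => by
    have h := ha i
    rw [partialD_div _ _ _ hg', div_eq_zero_iff, or_iff_left (pow_ne_zero 2 hg'), partialD_series,
      partialD_series, ← map_mul, ← map_mul, sub_eq_zero] at h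
    exact series_injective h
  exact ⟨c, by rw [map_mul, mul_div_cancel_right₀ _ hg']⟩

/-- Taylor expansion of polynomials at a point. -/
noncomputable def taylor (x : Fin 3 → ℂ) : Poly3 →ₐ[ℂ] Series3 :=
  MvPolynomial.aeval fun i => MvPowerSeries.X i + MvPowerSeries.C (x i)

theorem constantCoeff_taylor (x : Fin 3 → ℂ) (p : Poly3) :
    MvPowerSeries.constantCoeff (taylor x p) = MvPolynomial.eval x p := by
  induction p using MvPolynomial.induction_on with
  | C c => simp [taylor, MvPowerSeries.algebraMap_apply]
  | add p q hp hq => rw [map_add, map_add, hp, hq, map_add]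
  | mul_X p i hp => rw [map_mul, map_mul, hp, map_mul]; simp [taylor]

theorem pderiv_taylor (x : Fin 3 → ℂ) (i : Fin 3) (p : Poly3) :
    MvPowerSeries.pderiv ℂ i (taylor x p) = taylor x (MvPolynomial.pderiv i p) := by
  induction p using MvPolynomial.induction_on with
  | C c => simp [taylor, MvPowerSeries.algebraMap_apply]
  | add p q hp hq => rw [map_add, map_add, hp, hq, map_add, map_add]
  | mul_X p j hp =>
    rw [map_mul, Derivation.leibniz, Derivation.leibniz, hp, smul_eq_mul, smul_eq_mul,
      smul_eq_mul, smul_eq_mul, map_add, map_mul, map_mul]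
    congr 2
    classical
    simp only [taylor, MvPolynomial.aeval_X, map_add, MvPowerSeries.pderiv_C, add_zero,
      MvPowerSeries.pderiv_X, MvPolynomial.pderiv_X]
    rcases eq_or_ne i j with rfl | hij
    · simp
    · simp [Pi.single_eq_of_ne hij.symm]

/-- Expansion is translation by `x`, inverted by translation by `-x`, followed by the inclusion of
polynomials in power series. -/
theorem taylor_injective (x : Fin 3 → ℂ) : Function.Injective (taylor x) := by
  let s : (Fin 3 → ℂ) → Poly3 →ₐ[ℂ] Poly3 := fun y =>
    MvPolynomial.aeval fun i => MvPolynomial.X i + MvPolynomial.C (y i)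
  have h1 : taylor x = (MvPolynomial.coeToMvPowerSeries.algHom ℂ).comp (s x) := by
    apply MvPolynomial.algHom_ext
    intro i
    simp [taylor, s]
  have h2 : (s (-x)).comp (s x) = AlgHom.id ℂ Poly3 := by
    apply MvPolynomial.algHom_ext
    intro i
    simp [s, MvPolynomial.algebraMap_eq]
  have h3 : Function.Injective (s x) :=
    Function.LeftInverse.injective (g := s (-x)) fun p => congrArg (fun φ => φ p) h2
  rw [h1]
  intro p q hpq
  apply h3
  have : ((s x p : Poly3) : Series3) = (s x q : Poly3) := by simpa using hpq
  exact_mod_cast this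

theorem taylor_series_injective (x : Fin 3 → ℂ) :
    Function.Injective ((algebraMap Series3 Mero3).comp (taylor x : Poly3 →+* Series3)) := by
  rw [RingHom.coe_comp]
  exact series_injective.comp (taylor_injective x)

/-- The embedding of rational functions given by expansion at a point. -/
noncomputable def taylorHom (x : Fin 3 → ℂ) : Rat3 →+* Mero3 :=
  IsFractionRing.lift (taylor_series_injective x)

theorem taylorHom_algebraMap (x : Fin 3 → ℂ) (p : Poly3) :
    taylorHom x (algebraMap Poly3 Rat3 p) = algebraMap Series3 Mero3 (taylor x p) :=
  IsFractionRing.lift_algebraMap (taylor_series_injective x) p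

/-- Formal meromorphic functions as an extension of the rational functions, by expansion at a
point. -/
@[reducible]
noncomputable def taylorAlgebra (x : Fin 3 → ℂ) : Algebra Rat3 Mero3 :=
  (taylorHom x).toAlgebra

theorem taylorAlgebra_diffExtension (x : Fin 3 → ℂ) :
    @DiffExtension Rat3 Mero3 _ _ _ _ (taylorAlgebra x) := by
  let := taylorAlgebra x
  have hp : ∀ p : Poly3, algebraMap Rat3 Mero3 (algebraMap Poly3 Rat3 p) =
    algebraMap Series3 Mero3 (taylor x p) := taylorHom_algebraMap x
  refine ⟨fun i a => ?_⟩
  obtain ⟨p, q, hq, rfl⟩ := FracDeriv.exists_div (A := Poly3) a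
  have hq' := FracDeriv.algebraMap_ne (F := Rat3) hq
  have hq'' : algebraMap Rat3 Mero3 (algebraMap Poly3 Rat3 q) ≠ 0 := by simpa using hq'
  rw [map_div₀, partialD_div _ _ _ hq', partialD_div _ _ _ hq'', map_div₀, map_sub, map_mul,
    map_mul, map_pow]
  simp only [partialD_poly, hp, partialD_series, pderiv_taylor]

/-- Finitely many rational functions are regular at a common point. -/
theorem exists_regular_point {ι : Type*} [Finite ι] (r : ι → Rat3) :
    ∃ x : Fin 3 → ℂ, ∀ i, ∃ f : Series3,
      taylorHom x (r i) = algebraMap Series3 Mero3 f := by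
  have := Fintype.ofFinite ι
  choose p q hq hr using fun i => FracDeriv.exists_div (A := Poly3) (r i)
  have hQ : ∏ i, q i ≠ 0 := Finset.prod_ne_zero_iff.mpr fun i _ => hq i
  obtain ⟨x, hx⟩ : ∃ x, MvPolynomial.eval x (∏ i, q i) ≠ 0 := by
    by_contra! h
    exact hQ (MvPolynomial.funext fun x => by rw [h, map_zero])
  refine ⟨x, fun i => ⟨taylor x (p i) * (taylor x (q i))⁻¹, ?_⟩⟩
  have hqi : MvPolynomial.eval x (q i) ≠ 0 := fun h0 => hx (by
    rw [map_prod]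
    exact Finset.prod_eq_zero (Finset.mem_univ i) h0)
  have hinv := MvPowerSeries.mul_inv_cancel (taylor x (q i)) (by rwa [constantCoeff_taylor])
  have hne : algebraMap Series3 Mero3 (taylor x (q i)) ≠ 0 := by
    refine FracDeriv.algebraMap_ne fun h0 => ?_
    rw [h0, zero_mul] at hinv
    exact zero_ne_one hinv
  rw [hr i, map_div₀, taylorHom_algebraMap, taylorHom_algebraMap, div_eq_iff hne, ← map_mul, mul_assoc, mul_comm _ (taylor x (q i)), hinv, mul_one]

/-- Formal solutions of `dm = m α` and `dφ = ω / m` at a common regular point. -/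
theorem exists_formal_solution {α ω : OneForm Rat3} (hα : dOne α = 0)
    (hω : wedgeOneOne α ω = dOne ω) :
    ∃ (x : Fin 3 → ℂ) (m φ : Mero3), m ≠ 0 ∧
      (∀ i, partialD i m = m * taylorHom x (α i)) ∧
      ∀ i, partialD i φ = m⁻¹ * taylorHom x (ω i) := by
  obtain ⟨x, hx⟩ := exists_regular_point (Sum.elim α ω)
  let := taylorAlgebra x
  have := taylorAlgebra_diffExtension x
  choose A hA using fun i => hx (Sum.inl i)
  choose W hW using fun i => hx (Sum.inr i)
  have hA' : ∀ i, algebraMap Rat3 Mero3 (α i) = algebraMap Series3 Mero3 (A i) := hA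
  have hW' : ∀ i, algebraMap Rat3 Mero3 (ω i) = algebraMap Series3 Mero3 (W i) := hW
  rw [dOne_eq_zero_iff] at hα
  rw [wedgeOneOne_eq_dOne_iff] at hω
  obtain ⟨g, hg0, hg⟩ := exists_pderiv_eq (a := A) fun i j => by
    have := congrArg (algebraMap Rat3 Mero3) (hα i j)
    rw [← partialD_algebraMap, ← partialD_algebraMap, hA', hA', partialD_series,
      partialD_series] at this
    exact series_injective this
  obtain ⟨m, hm1, hm⟩ := exists_exp hg0
  have hinv := MvPowerSeries.mul_inv_cancel m (by simp [hm1])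
  -- The integrand is closed because d(ω/m) = (dω − α ∧ ω)/m = 0.
  obtain ⟨φ, -, hφ⟩ := exists_pderiv_eq (a := fun i => m⁻¹ * W i) fun i j => by
    have := congrArg (algebraMap Rat3 Mero3) (hω i j)
    rw [map_sub, map_sub, map_mul, map_mul, ← partialD_algebraMap, ← partialD_algebraMap, hA', hA',
      hW', hW', partialD_series, partialD_series, ← map_mul, ← map_mul, ← map_sub,
      ← map_sub] at this
    have h1 := series_injective this
    simp only [Derivation.leibniz, smul_eq_mul, MvPowerSeries.pderiv_inv', hm, hg]
    linear_combination m⁻¹ * h1 - m⁻¹ * (W j * A i - W i * A j) * hinv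
  have hmne : algebraMap Series3 Mero3 m ≠ 0 := by
    refine FracDeriv.algebraMap_ne fun h0 => ?_
    rw [h0, zero_mul] at hinv
    exact zero_ne_one hinv
  refine ⟨x, algebraMap Series3 Mero3 m, algebraMap Series3 Mero3 φ, hmne, fun i => ?_,
    fun i => ?_⟩
  · rw [partialD_series, hm, hg, map_mul]
    exact congrArg _ (hA' i).symm
  · rw [partialD_series, hφ, map_mul]
    have : algebraMap Series3 Mero3 m⁻¹ = (algebraMap Series3 Mero3 m)⁻¹ := by
      exact eq_inv_of_mul_eq_one_right (by rw [← map_mul, hinv, map_one])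
    rw [this]
    exact congrArg _ (hW' i).symm

end FormalMeromorphic

end LiouvillianForms

namespace LiouvillianForms

open DiffField IntermediateField

/-! ### Realising m and φ in a Liouvillian extension. -/

section Existence

theorem isConst_C (c : ℂ) : IsConst (algebraMap Poly3 Rat3 (MvPolynomial.C c)) := fun i => by
  rw [partialD_poly, MvPolynomial.pderiv_C, map_zero]

theorem taylorHom_C (x : Fin 3 → ℂ) (c : ℂ) :
    taylorHom x (algebraMap Poly3 Rat3 (MvPolynomial.C c)) =
      algebraMap Series3 Mero3 (MvPowerSeries.C c) := by
  rw [taylorHom_algebraMap]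
  simp [taylor, MvPowerSeries.algebraMap_apply]

/-- The constants of the field of rational functions are the complex numbers. -/
theorem exists_eq_C_of_isConst_rat {a : Rat3} (ha : IsConst a) :
    ∃ c : ℂ, a = algebraMap Poly3 Rat3 (MvPolynomial.C c) := by
  let := taylorAlgebra 0
  have := taylorAlgebra_diffExtension 0
  have h : IsConst (taylorHom 0 a) := fun i => by
    have h1 := partialD_algebraMap (F := Mero3) i a
    rw [ha i, map_zero] at h1
    exact h1
  obtain ⟨c, hc⟩ := exists_eq_C_of_isConst h
  refine ⟨c, (taylorHom 0).injective ?_⟩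
  rw [hc, taylorHom_C]

/-- A closed form has an exponential `m` of its integral, and `ω / m` an integral `φ`, in a
Liouvillian extension. -/
theorem exists_liouvillian_solution {α ω : OneForm Rat3} (hα : dOne α = 0)
    (hω : wedgeOneOne α ω = dOne ω) :
    ∃ (L : Type) (_ : Field L) (_ : DiffField L) (_ : Algebra Rat3 L),
      IsLiouvillianExtension Rat3 L ∧ ∃ m φ : L, m ≠ 0 ∧ m⁻¹ • dZero m = formMap L α ∧
        dZero φ = m⁻¹ • formMap L ω := by
  obtain ⟨x, m, φ, hm0, hm, hφ⟩ := exists_formal_solution hα hω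
  let := taylorAlgebra x
  have := taylorAlgebra_diffExtension x
  have hm' : ∀ i, partialD i m / m = algebraMap Rat3 Mero3 (α i) := fun i => by
    rw [hm, mul_div_cancel_left₀ _ hm0]
    rfl
  have hcl₁ : IsDiffClosed Rat3⟮m⟯ := (LiouvillianStep.descent isDiffClosed_bot
    ⟨m, (bot_sup_eq _).symm, Or.inl ⟨hm0, fun i => by
      rw [hm']
      exact IntermediateField.algebraMap_mem _ _⟩⟩).1
  have hcl : IsDiffClosed (Rat3⟮m⟯ ⊔ Rat3⟮φ⟯) := (LiouvillianStep.descent hcl₁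
    ⟨φ, rfl, Or.inr (Or.inl fun i => by
      rw [hφ]
      exact mul_mem (inv_mem (mem_adjoin_simple_self _ m))
        (IntermediateField.algebraMap_mem _ _))⟩).1
  let N := Rat3⟮m⟯ ⊔ Rat3⟮φ⟯
  let := hcl.diffField
  have hext : DiffExtension Rat3 N := hcl.diffExtension_left
  let m' : N := ⟨m, (le_sup_left : _ ≤ N) (mem_adjoin_simple_self _ m)⟩
  let φ' : N := ⟨φ, (le_sup_right : _ ≤ N) (mem_adjoin_simple_self _ φ)⟩
  have hm0' : m' ≠ 0 := fun h => hm0 (congrArg Subtype.val h)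
  have hφ' : ∀ i, partialD i φ' = m'⁻¹ * algebraMap Rat3 N (ω i) := fun i => Subtype.ext (hφ i)
  refine ⟨N, inferInstance, hcl.diffField, inferInstance, ⟨hext, ?_, 2,
    fun | 0 => ⊥ | 1 => Rat3⟮m'⟯ | _ => ⊤, rfl, rfl, ?_⟩, m', φ', hm0', ?_, ?_⟩
  -- A constant of `N` is a constant of `Mero3`, hence a complex number, which already lies in
  -- `Rat3`.
  · intro a ha
    have ha' : IsConst (a : Mero3) := fun i => congrArg Subtype.val (ha i)
    obtain ⟨c, hc⟩ := exists_eq_C_of_isConst ha'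
    refine ⟨_, isConst_C c, Subtype.ext ?_⟩
    rw [hc, ← taylorHom_C x]
    rfl
  · intro i hi
    interval_cases i
    · refine ⟨m', (bot_sup_eq _).symm, Or.inl ⟨hm0', fun i => ?_⟩⟩
      have : partialD i m' / m' = algebraMap Rat3 N (α i) := Subtype.ext (hm' i)
      rw [this]
      exact IntermediateField.algebraMap_mem _ _
    · refine ⟨φ', ?_, Or.inr (Or.inl fun i => ?_)⟩
      · change ⊤ = Rat3⟮m'⟯ ⊔ Rat3⟮φ'⟯
        apply lift_injective
        rw [lift_sup, lift_adjoin_simple, lift_adjoin_simple, lift_top]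
      · rw [hφ']
        exact mul_mem (inv_mem (mem_adjoin_simple_self _ m'))
          (IntermediateField.algebraMap_mem _ _)
  · funext i
    have : partialD i m' / m' = algebraMap Rat3 N (α i) := Subtype.ext (hm' i)
    rw [Pi.smul_apply, smul_eq_mul, mul_comm, ← div_eq_mul_inv]
    exact this
  · funext i
    exact hφ' i

end Existence

end LiouvillianForms

namespace LiouvillianForms

open DiffField Polynomial IntermediateField

/-! ### Sums of exact and logarithmic forms. -/

section LogarithmicForms

variable (K : Type v) [Field K] [DiffField K]

/-- The additive group generated by exact forms and constant multiples of logarithmic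
differentials. -/
def logForms : AddSubgroup (OneForm K) :=
  AddSubgroup.closure ({η : OneForm K | ∃ u : K, η = dZero u} ∪
    {η : OneForm K | ∃ c f : K, IsConst c ∧ η = (c / f) • dZero f})

variable {K}

theorem dZero_mem_logForms (u : K) : dZero u ∈ logForms K :=
  AddSubgroup.subset_closure (Or.inl ⟨u, rfl⟩)

theorem smul_dZero_mem_logForms {c : K} (hc : IsConst c) (f : K) :
    (c / f) • dZero f ∈ logForms K :=
  AddSubgroup.subset_closure (Or.inr ⟨c, f, hc, rfl⟩)

theorem dOne_neg (a : OneForm K) : dOne (-a) = -dOne a := by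
  ext i
  fin_cases i <;> simp [dOne] <;> ring

theorem dOne_eq_zero_of_mem_logForms {a : OneForm K} (ha : a ∈ logForms K) : dOne a = 0 := by
  induction ha using AddSubgroup.closure_induction with
  | mem a h =>
    rcases h with ⟨u, rfl⟩ | ⟨c, f, hc, rfl⟩
    · exact dOne_dZero u
    · have h1 := dOne_logDeriv f
      rw [dOne_eq_zero_iff] at h1 ⊢
      intro i j
      have h2 := h1 i j
      simp only [Pi.smul_apply, dZero, smul_eq_mul, div_eq_mul_inv, mul_assoc] at h2 ⊢
      rw [(partialD i).leibniz c, (partialD j).leibniz c, hc i, hc j, h2]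
      simp
  | zero =>
    rw [dOne_eq_zero_iff]
    simp
  | add a b _ _ ha hb => rw [dOne_add, ha, hb, add_zero]
  | neg a _ ha => rw [dOne_neg, ha, neg_zero]

end LogarithmicForms

/-! ### Hermite reduction and residues in one variable. -/

section OneVariable

variable {k : Type u} {K : Type v} [Field k] [Field K] [Algebra k K] {t : K}

theorem exists_eq_div_coprime (ht : Transcendental k t) {x : K} (hx : x ∈ k⟮t⟯) :
    ∃ r s : k[X], s ≠ 0 ∧ IsCoprime r s ∧ x = aeval t r / aeval t s := by
  let e := RatFunc.algEquivOfTranscendental t ht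
  let w := e.symm ⟨x, hx⟩
  refine ⟨w.num, w.denom, w.denom_ne_zero, w.isCoprime_num_denom, ?_⟩
  rw [← RatFunc.algEquivOfTranscendental_apply t ht]
  change x = (e (e.symm ⟨x, hx⟩) : K)
  rw [AlgEquiv.apply_symm_apply]

theorem not_dvd_derivative [CharZero k] {q : k[X]} (hq : Irreducible q) : ¬ q ∣ derivative q :=
  fun h => hq.not_isUnit (hq.separable.isUnit_of_dvd' dvd_rfl h)

theorem exists_derivative_eq [CharZero k] (p : k[X]) : ∃ P : k[X], derivative P = p := by
  induction p using Polynomial.induction_on' with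
  | add p q hp hq =>
    obtain ⟨P, rfl⟩ := hp
    obtain ⟨Q, rfl⟩ := hq
    exact ⟨P + Q, derivative_add⟩
  | monomial n a =>
    refine ⟨monomial (n + 1) (a / (n + 1)), ?_⟩
    rw [derivative_monomial, Nat.add_sub_cancel]
    congr 1
    have : ((n : k) + 1) ≠ 0 := Nat.cast_add_one_ne_zero n
    push_cast
    field_simp

theorem exists_eq_pow_mul {q s : k[X]} (hq : Irreducible q) (hs : s ≠ 0) (h : q ∣ s) :
    ∃ m V, s = q ^ (m + 1) * V ∧ ¬ q ∣ V := by
  obtain ⟨V, h1, h2⟩ :=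
    (FiniteMultiplicity.of_prime_left hq.prime hs).exists_eq_pow_mul_and_not_dvd
  generalize multiplicity q s = m at h1
  obtain _ | m := m
  · exact absurd (by simpa [h1] using h) h2
  · exact ⟨m, V, h1, h2⟩

/-- A derivative has no simple poles. -/
theorem dvd_of_derivative_fraction [CharZero k] {q r s H G : k[X]} (hq : Irreducible q)
    (hrs : IsCoprime r s) (hs : s ≠ 0) (hH : ¬ q ∣ H)
    (h : (derivative r * s - r * derivative s) * (q * H) = G * s ^ 2) : q ∣ G := by
  by_cases hqs : q ∣ s
  · exfalso
    have hqr : ¬ q ∣ r := fun hqr => hq.not_isUnit (hrs.isUnit_of_dvd' hqr hqs)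
    obtain ⟨m, V, rfl, hV⟩ := exists_eq_pow_mul hq hs hqs
    have hq0 : q ^ (m + 1) ≠ 0 := pow_ne_zero _ hq.ne_zero
    -- If `q` has multiplicity m + 1 in `s`, then (r/s)′ has a pole of order m + 2 ≥ 2 there, its
    -- leading term containing (m + 1) r q′. A simple pole cannot match it.
    have h1 : q ^ (m + 1) * (H * r * V * derivative q * C ((m : k) + 1)) =
        q ^ (m + 1) * (q * (H * (derivative r * V - r * derivative V) - G * q ^ m * V ^ 2)) := by
      rw [derivative_mul, derivative_pow, Nat.add_sub_cancel] at h
      push_cast at h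
      linear_combination -h
    have h2 : q ∣ H * r * V * derivative q * C ((m : k) + 1) :=
      ⟨_, mul_left_cancel₀ hq0 h1⟩
    have hu : IsUnit (C ((m : k) + 1)) := isUnit_C.mpr (Nat.cast_add_one_ne_zero m).isUnit
    rcases hq.prime.dvd_or_dvd (hu.dvd_mul_right.mp h2) with h3 | h3
    · rcases hq.prime.dvd_or_dvd h3 with h4 | h4
      · exact (hq.prime.dvd_or_dvd h4).elim hH hqr
      · exact hV h4
    · exact not_dvd_derivative hq h3
  · have h1 : q ∣ G * s ^ 2 := ⟨(derivative r * s - r * derivative s) * H, by rw [← h]; ring⟩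
    exact (hq.prime.dvd_or_dvd h1).resolve_right fun h2 => hqs (hq.prime.dvd_of_dvd_pow h2)

theorem exists_dvd_sub_mul {q x : k[X]} (hq : Irreducible q) (hx : ¬ q ∣ x) (A : k[X]) :
    ∃ S, q ∣ A - S * x := by
  obtain ⟨a, b, hab⟩ := (hq.coprime_iff_not_dvd).mpr hx
  exact ⟨A * b, A * a, by linear_combination -A * hab⟩

theorem derivative_aeval (S p : k[X]) :
    derivative (aeval S p) = aeval S (derivative p) * derivative S := by
  rw [← comp_eq_aeval, ← comp_eq_aeval, derivative_comp, mul_comm]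

variable [DiffField k]

theorem coeffD_aeval (i : Fin 3) (S p : k[X]) :
    coeffD i (aeval S p) = aeval S (coeffD i p) + aeval S (derivative p) * coeffD i S := by
  let : Differential k := ⟨partialD i⟩
  let : Differential k[X] := ⟨coeffD i⟩
  have : DifferentialAlgebra k k[X] := ⟨coeffD_C i⟩
  exact Differential.deriv_aeval_eq S p

/-- A residue killed by all derivations of the residue field is a complex number. -/
theorem exists_dvd_sub_C [CharZero k] [Algebra ℂ k]
    (hconst : ∀ a : k, IsConst a → ∃ c : ℂ, algebraMap ℂ k c = a) {q S : k[X]}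
    (hq : Irreducible q)
    (h : ∀ i, q ∣ derivative q * coeffD i S - derivative S * coeffD i q) :
    ∃ c : ℂ, q ∣ S - C (algebraMap ℂ k c) := by
  have : Fact (Irreducible q) := ⟨hq⟩
  let s : AdjoinRoot q := AdjoinRoot.mk q S
  have hdvd : ∀ p : k[X], aeval s p = 0 ↔ q ∣ aeval S p := fun p => by
    rw [← AdjoinRoot.mk_eq_zero]
    have : aeval s p = AdjoinRoot.mk q (aeval S p) := by
      exact (aeval_algHom_apply (AdjoinRoot.mkₐ q) S p)
    rw [this]
  have hint : IsIntegral k s := by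
    have := (AdjoinRoot.powerBasis hq.ne_zero).finite
    exact IsIntegral.of_finite k s
  -- The hypothesis says that the class `s` of `S` in k[X]/(q) is a constant. Differentiating the
  -- coefficients of its monic minimal polynomial therefore gives a polynomial of smaller degree
  -- vanishing at `s`. So these coefficients are complex numbers, and `s` is one too because ℂ is
  -- algebraically closed.
  have hcoeff : ∀ i, coeffD i (minpoly k s) = 0 := by
    intro i
    by_contra hne
    have h0 : aeval s (coeffD i (minpoly k s)) = 0 := by
      rw [hdvd]
      obtain ⟨w, hw⟩ := (hdvd (minpoly k s)).mp (minpoly.aeval k s)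
      have h1 := congrArg (coeffD i) hw
      have h2 := congrArg derivative hw
      rw [coeffD_aeval, Derivation.leibniz, smul_eq_mul, smul_eq_mul] at h1
      rw [derivative_aeval, derivative_mul] at h2
      have h3 : q ∣ derivative q * aeval S (coeffD i (minpoly k s)) := by
        obtain ⟨v, hv⟩ := h i
        refine ⟨derivative q * coeffD i w - derivative w * coeffD i q -
          aeval S (derivative (minpoly k s)) * v, ?_⟩
        linear_combination derivative q * h1 - coeffD i q * h2 -
          aeval S (derivative (minpoly k s)) * hv
      exact (hq.prime.dvd_or_dvd h3).resolve_left (not_dvd_derivative hq)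
    have h1 := minpoly.degree_le_of_ne_zero k s hne h0
    have h2 : (coeffD i (minpoly k s)).degree < (minpoly k s).degree := by
      rw [degree_eq_natDegree (minpoly.ne_zero hint), degree_lt_iff_coeff_zero]
      intro n hn
      rw [coeff_coeffD]
      rcases hn.eq_or_lt with rfl | hn
      · rw [(minpoly.monic hint).coeff_natDegree, Derivation.map_one_eq_zero]
      · rw [coeff_eq_zero_of_natDegree_lt hn, map_zero]
    exact absurd h1 (not_le.mpr h2)
  have hlift : minpoly k s ∈ lifts (algebraMap ℂ k) := by
    rw [lifts_iff_coeff_lifts]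
    intro n
    exact hconst _ fun i => by rw [← coeff_coeffD, hcoeff, coeff_zero]
  obtain ⟨p, hp⟩ := (mem_lifts _).mp hlift
  have hp0 : p ≠ 0 := by
    rintro rfl
    exact minpoly.ne_zero hint (by rw [← hp, Polynomial.map_zero])
  have hsp : aeval s p = 0 := by
    rw [← aeval_map_algebraMap k, hp, minpoly.aeval]
  have hint' : IsIntegral ℂ s := (show IsAlgebraic ℂ s from ⟨p, hp0, hsp⟩).isIntegral
  obtain ⟨c, hc⟩ := minpoly.mem_range_of_degree_eq_one ℂ s
    (IsAlgClosed.degree_eq_one_of_irreducible ℂ (minpoly.irreducible hint'))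
  refine ⟨c, ?_⟩
  rw [← AdjoinRoot.mk_eq_zero, map_sub, sub_eq_zero]
  exact hc.symm

variable [DiffField K]

/-- The hypotheses on a variable `t` over a differential field `k` of functions which do not
depend on it. -/
structure IsVariable (k : Type u) [Field k] [DiffField k] [Algebra k K] (i₀ : Fin 3) (t : K) :
    Prop where
  self : partialD i₀ t = 1
  other : ∀ i, i ≠ i₀ → partialD i t = 0
  base : ∀ a : k, partialD i₀ a = 0

variable {i₀ : Fin 3}

theorem IsVariable.coeffD_self (hv : IsVariable k i₀ t) (p : k[X]) : coeffD i₀ p = 0 := by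
  ext n
  rw [coeff_coeffD, hv.base, coeff_zero]

variable [DiffExtension k K]

theorem IsVariable.transcendental [CharZero k] (hv : IsVariable k i₀ t) :
    Transcendental k t := fun h => by
  have := derivation_eq_zero_of_isAlgebraic (partialD i₀)
    (fun a => by rw [partialD_algebraMap, hv.base, map_zero]) h
  rw [hv.self] at this
  exact one_ne_zero this

theorem IsVariable.partialD_self_aeval (hv : IsVariable k i₀ t) (p : k[X]) :
    partialD i₀ (aeval t p) = aeval t (derivative p) := by
  rw [partialD_aeval, hv.coeffD_self, hv.self, map_zero, zero_add, mul_one]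

theorem IsVariable.partialD_other_aeval (hv : IsVariable k i₀ t) {i : Fin 3} (hi : i ≠ i₀)
    (p : k[X]) : partialD i (aeval t p) = aeval t (coeffD i p) := by
  rw [partialD_aeval, hv.other i hi, mul_zero, add_zero]

theorem IsVariable.isDiffClosed (hv : IsVariable k i₀ t) : IsDiffClosed k⟮t⟯ := by
  apply isDiffClosed_adjoin_simple
  intro i
  rcases eq_or_ne i i₀ with rfl | hi
  · rw [hv.self]
    exact one_mem _
  · rw [hv.other i hi]
    exact zero_mem _

/-- In lowest terms (r/s)′ = 0 makes `s` divide s′, so s′ = 0 by degree and then r′ = 0. -/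
theorem IsVariable.exists_eq_algebraMap [CharZero k] (hv : IsVariable k i₀ t) {b : K}
    (hb : b ∈ k⟮t⟯) (h : partialD i₀ b = 0) : ∃ a : k, algebraMap k K a = b := by
  have ht := hv.transcendental
  obtain ⟨r, s, hs, hrs, rfl⟩ := exists_eq_div_coprime ht hb
  have hst := aeval_ne_zero_of_transcendental ht hs
  rw [partialD_div _ _ _ hst, div_eq_zero_iff, or_iff_left (pow_ne_zero 2 hst),
    hv.partialD_self_aeval, hv.partialD_self_aeval, ← map_mul, ← map_mul, ← map_sub] at h
  have h1 : derivative r * s - r * derivative s = 0 := by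
    by_contra hne
    exact aeval_ne_zero_of_transcendental ht hne h
  have h2 : s ∣ derivative s := hrs.symm.dvd_of_dvd_mul_left ⟨derivative r, by
    linear_combination -h1⟩
  have h3 : derivative s = 0 := by
    by_contra hne
    have := natDegree_le_of_dvd h2 hne
    have h4 : s.natDegree ≠ 0 := fun h0 => hne (derivative_of_natDegree_zero h0)
    exact absurd this (not_le.mpr (natDegree_derivative_lt h4))
  have h4 : derivative r = 0 := by
    rw [h3, mul_zero, sub_zero] at h1
    exact (mul_eq_zero.mp h1).resolve_right hs
  have h5 := eq_C_of_derivative_eq_zero h3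
  have h6 := eq_C_of_derivative_eq_zero h4
  refine ⟨r.coeff 0 / s.coeff 0, ?_⟩
  rw [h5, h6, aeval_C, aeval_C, map_div₀]
  simp

/-- A function satisfying the closedness condition has constant residue at a simple pole. -/
theorem IsVariable.dvd_residue [CharZero k] (hv : IsVariable k i₀ t) {q D S W : k[X]}
    (hq : Irreducible q) (hD : ¬ q ∣ D) {i : Fin 3} (hi : i ≠ i₀) {a : K} (ha : a ∈ k⟮t⟯)
    (h : partialD i (aeval t (S * (derivative q * D) + q * W) / aeval t (q * D)) =
      partialD i₀ a) :
    q ∣ derivative q * coeffD i S - derivative S * coeffD i q := by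
  have ht := hv.transcendental
  have hD0 : D ≠ 0 := fun h0 => hD (h0 ▸ dvd_zero q)
  have hqt := aeval_ne_zero_of_transcendental ht hq.ne_zero
  have hDt := aeval_ne_zero_of_transcendental ht hD0
  have hmem := aeval_mem_adjoin_simple (K := k) t
  have hw : a - aeval t S * aeval t (coeffD i q) / aeval t q ∈ k⟮t⟯ :=
    sub_mem ha (div_mem (mul_mem (hmem _) (hmem _)) (hmem _))
  have hsplit : aeval t (S * (derivative q * D) + q * W) / aeval t (q * D) =
      aeval t S * aeval t (derivative q) / aeval t q + aeval t W / aeval t D := by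
    simp only [map_add, map_mul]
    field_simp
  -- With ′ for ∂ᵢ₀ and a subscript for the coefficient derivative, ∂ᵢ(S q′/q) = (S qᵢ/q)′ + (q′Sᵢ −
  -- S′qᵢ)/q. Thus the last term is a derivative up to terms without a pole at `q`, and a derivative
  -- has no simple poles.
  have hpd : partialD i₀ (a - aeval t S * aeval t (coeffD i q) / aeval t q) *
      aeval t (q * D ^ 2) =
      aeval t ((derivative q * coeffD i S - derivative S * coeffD i q) * D ^ 2 +
        q * (coeffD i W * D - W * coeffD i D)) := by
    rw [hsplit, map_add, partialD_div _ _ _ hqt, partialD_div _ _ _ hDt] at h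
    rw [map_sub, ← h, partialD_div _ _ _ hqt]
    simp only [Derivation.leibniz, hv.partialD_self_aeval, hv.partialD_other_aeval hi,
      coeffD_derivative, map_add, map_sub, map_mul, map_pow, smul_eq_mul]
    field_simp
    ring
  obtain ⟨r, s, hs, hrs, hwrs⟩ := exists_eq_div_coprime ht hw
  have hst := aeval_ne_zero_of_transcendental ht hs
  rw [hwrs, partialD_div _ _ _ hst, hv.partialD_self_aeval, hv.partialD_self_aeval,
    div_mul_eq_mul_div, div_eq_iff (pow_ne_zero 2 hst)] at hpd
  simp only [← map_mul, ← map_sub, ← map_pow] at hpd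
  have hpoly := transcendental_iff_injective.mp ht hpd
  have hdvd := dvd_of_derivative_fraction hq hrs hs
    (fun h2 => hD (hq.prime.dvd_of_dvd_pow h2)) hpoly
  rw [dvd_add_left (dvd_mul_right q _)] at hdvd
  exact (hq.prime.dvd_or_dvd hdvd).resolve_right fun h2 => hD (hq.prime.dvd_of_dvd_pow h2)

/-- Hermite reduction, by induction on the degree of the denominator: subtracting an exact form
lowers a multiple pole, and subtracting c dq/q removes a simple one. The closedness condition
persists because the subtracted forms are closed; it is what makes the residue `c` constant. -/
theorem IsVariable.exists_logForm_aux [CharZero k] [Algebra ℂ k]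
    (hconst : ∀ a : k, IsConst a ↔ ∃ c : ℂ, algebraMap ℂ k c = a)
    (hv : IsVariable k i₀ t) (n : ℕ) : ∀ A B : k[X], B ≠ 0 → B.natDegree ≤ n →
      (∀ i, i ≠ i₀ → ∃ a ∈ k⟮t⟯, partialD i (aeval t A / aeval t B) = partialD i₀ a) →
      ∃ δ ∈ logForms K, (∀ i, δ i ∈ k⟮t⟯) ∧ δ i₀ = aeval t A / aeval t B := by
  have ht := hv.transcendental
  have hmem := aeval_mem_adjoin_simple (K := k) t
  have hcl := hv.isDiffClosed
  have hsub : ∀ {c : K}, (∀ i, i ≠ i₀ → ∃ a ∈ k⟮t⟯, partialD i c = partialD i₀ a) →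
      ∀ δ ∈ logForms K, (∀ i, δ i ∈ k⟮t⟯) →
      ∀ i, i ≠ i₀ → ∃ a ∈ k⟮t⟯, partialD i (c - δ i₀) = partialD i₀ a := by
    intro c hc δ hδ hδ' i hi
    obtain ⟨a, ha, h⟩ := hc i hi
    refine ⟨a - δ i, sub_mem ha (hδ' i), ?_⟩
    rw [map_sub, map_sub, h, (dOne_eq_zero_iff δ).mp (dOne_eq_zero_of_mem_logForms hδ) i i₀]
  induction n with
  | zero =>
    intro A B hB hdeg _
    obtain ⟨P, hP⟩ := exists_derivative_eq (C (B.coeff 0)⁻¹ * A)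
    refine ⟨dZero (aeval t P), dZero_mem_logForms _, fun i => hcl i _ (hmem P), ?_⟩
    have hB' := eq_C_of_natDegree_le_zero hdeg
    rw [dZero, hv.partialD_self_aeval, hP, hB', map_mul, aeval_C, aeval_C, map_inv₀]
    simp [div_eq_mul_inv, mul_comm]
  | succ n ih =>
    intro A B hB hdeg hclosed
    by_cases hdeg' : B.natDegree ≤ n
    · exact ih A B hB hdeg' hclosed
    obtain ⟨q, hq, hqB⟩ := exists_irreducible_of_natDegree_pos (f := B) (by omega)
    obtain ⟨m, D, rfl, hD⟩ := exists_eq_pow_mul hq hB hqB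
    have hD0 : D ≠ 0 := right_ne_zero_of_mul hB
    have hqt := aeval_ne_zero_of_transcendental ht hq.ne_zero
    have hDt := aeval_ne_zero_of_transcendental ht hD0
    have hqm : q ^ m * D ≠ 0 := mul_ne_zero (pow_ne_zero m hq.ne_zero) hD0
    have hdeg2 : (q ^ m * D).natDegree ≤ n := by
      rw [pow_succ', mul_assoc, natDegree_mul hq.ne_zero hqm] at hdeg
      have := hq.natDegree_pos
      omega
    suffices ∃ δ ∈ logForms K, (∀ i, δ i ∈ k⟮t⟯) ∧ ∃ A' : k[X],
        aeval t A / aeval t (q ^ (m + 1) * D) - δ i₀ = aeval t A' / aeval t (q ^ m * D) by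
      obtain ⟨δ, hδ, hδ', A', hA'⟩ := this
      obtain ⟨ε, hε, hε', hε0⟩ := ih A' (q ^ m * D) hqm hdeg2
        (hA' ▸ hsub hclosed δ hδ hδ')
      refine ⟨ε + δ, add_mem hε hδ, fun i => add_mem (hε' i) (hδ' i), ?_⟩
      rw [Pi.add_apply, hε0, ← hA', sub_add_cancel]
    obtain _ | m := m
    · obtain ⟨S, W, hW⟩ := exists_dvd_sub_mul hq (x := derivative q * D)
        (fun h => (hq.prime.dvd_or_dvd h).elim (not_dvd_derivative hq) hD) A
      obtain rfl : A = S * (derivative q * D) + q * W := by linear_combination hW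
      rw [zero_add, pow_one] at hclosed ⊢
      obtain ⟨c, V, hV⟩ := exists_dvd_sub_C (fun a => (hconst a).mp) hq (S := S) (fun i => by
        rcases eq_or_ne i i₀ with rfl | hi
        · rw [hv.coeffD_self, hv.coeffD_self]
          simp
        · obtain ⟨a, ha, h⟩ := hclosed i hi
          exact hv.dvd_residue hq hD hi ha h)
      have hc : IsConst (algebraMap k K (algebraMap ℂ k c)) := fun i => by
        rw [partialD_algebraMap, (hconst _).mpr ⟨c, rfl⟩ i, map_zero]
      refine ⟨_, smul_dZero_mem_logForms hc (aeval t q), fun i => ?_, V * (derivative q * D) + W,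
        ?_⟩
      · exact mul_mem (div_mem (IntermediateField.algebraMap_mem _ _) (hmem q))
          (hcl i _ (hmem q))
      · have h1 := congrArg (aeval t) hV
        rw [map_sub, aeval_C, map_mul] at h1
        rw [Pi.smul_apply, dZero, hv.partialD_self_aeval, smul_eq_mul]
        simp only [map_add, map_mul, pow_zero, one_mul]
        field_simp
        linear_combination aeval t (derivative q) * aeval t D * h1
    -- The pole has order m + 2. The derivative of S/q^(m+1) has leading part −(m+1) S q′/q^(m+2),
    -- and `S` is chosen modulo `q` to match `A`.
    · obtain ⟨S, W, hW⟩ := exists_dvd_sub_mul hq (x := -(C ((m : k) + 1) * (derivative q * D)))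
        (fun h => by
          have hu : IsUnit (C ((m : k) + 1)) := isUnit_C.mpr (Nat.cast_add_one_ne_zero m).isUnit
          rw [dvd_neg, hu.dvd_mul_left] at h
          exact (hq.prime.dvd_or_dvd h).elim (not_dvd_derivative hq) hD) A
      refine ⟨dZero (aeval t S / aeval t (q ^ (m + 1))), dZero_mem_logForms _, fun i =>
        hcl i _ (div_mem (hmem _) (hmem _)), W - D * derivative S, ?_⟩
      have h1 := congrArg (aeval t) hW
      simp only [map_sub, map_mul, map_neg, map_add, map_natCast, map_one] at h1
      rw [dZero, partialD_div _ _ _ (by simpa using pow_ne_zero (m + 1) hqt),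
        hv.partialD_self_aeval, hv.partialD_self_aeval, derivative_pow, Nat.add_sub_cancel]
      simp only [map_sub, map_mul, map_pow, map_natCast]
      push_cast
      field_simp
      linear_combination aeval t q ^ (2 * m + 2) * h1

/-- A closed form in the variable `t` is the sum of a form in `logForms` and a closed form not
involving `t`. -/
theorem IsVariable.exists_logForm_add [CharZero k] [Algebra ℂ k]
    (hconst : ∀ a : k, IsConst a ↔ ∃ c : ℂ, algebraMap ℂ k c = a)
    (hv : IsVariable k i₀ t) {α : OneForm K} (hα : ∀ i, α i ∈ k⟮t⟯) (hd : dOne α = 0) :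
    ∃ δ ∈ logForms K, ∃ α' : OneForm k, α = δ + formMap K α' := by
  obtain ⟨A, B, hB, hAB⟩ := exists_eq_div_of_mem_adjoin (hα i₀)
  rw [dOne_eq_zero_iff] at hd
  obtain ⟨δ, hδ, hδ', hδ0⟩ := hv.exists_logForm_aux hconst B.natDegree A B hB le_rfl
    fun i _ => ⟨α i, hα i, by rw [← hAB, hd i i₀]⟩
  have hdδ := (dOne_eq_zero_iff δ).mp (dOne_eq_zero_of_mem_logForms hδ)
  -- Once the `i₀`-coefficient has been removed, closedness gives every remaining coefficient zero
  -- ∂ᵢ₀-derivative, so it is free of `t`.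
  choose α' hα' using fun i => hv.exists_eq_algebraMap (sub_mem (hα i) (hδ' i)) (by
    rw [map_sub, hd, hdδ, hAB, hδ0, sub_self])
  refine ⟨δ, hδ, α', funext fun i => ?_⟩
  rw [Pi.add_apply, formMap, hα', add_sub_cancel]

end OneVariable

end LiouvillianForms

namespace LiouvillianForms

open DiffField IntermediateField

/-! ### Closed rational forms are Darboux forms. -/

section RationalForms

theorem algebraMap_complex (c : ℂ) :
    algebraMap ℂ Rat3 c = algebraMap Poly3 Rat3 (MvPolynomial.C c) := by
  rw [IsScalarTower.algebraMap_apply ℂ Poly3 Rat3, MvPolynomial.algebraMap_eq]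

theorem partialD_X (i j : Fin 3) :
    partialD i (algebraMap Poly3 Rat3 (MvPolynomial.X j)) = if i = j then 1 else 0 := by
  rw [partialD_poly, MvPolynomial.pderiv_X, Pi.single_apply]
  split_ifs with h1 h2 h2
  · exact map_one _
  · exact absurd h1.symm h2
  · exact absurd h2.symm h1
  · exact map_zero _

/-- The field of rational functions which do not depend on one of the variables. -/
def kernelField (j : Fin 3) : IntermediateField ℂ Rat3 where
  carrier := {a | partialD j a = 0}
  mul_mem' {a b} ha hb := by
    change partialD j (a * b) = 0
    rw [partialD_mul, show partialD j a = 0 from ha, show partialD j b = 0 from hb,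
      mul_zero, mul_zero, add_zero]
  add_mem' {a b} ha hb := by
    change partialD j (a + b) = 0
    rw [map_add, show partialD j a = 0 from ha, show partialD j b = 0 from hb, add_zero]
  algebraMap_mem' c := by
    change partialD j (algebraMap ℂ Rat3 c) = 0
    rw [algebraMap_complex]
    exact isConst_C c j
  inv_mem' a ha := by
    change partialD j a⁻¹ = 0
    rw [partialD_inv, show partialD j a = 0 from ha, zero_div, neg_zero]

theorem isVariable_X {k : IntermediateField ℂ Rat3} (hcl : IsDiffClosed k) {j : Fin 3}
    (hk : k ≤ kernelField j) :
    @IsVariable Rat3 _ _ k _ hcl.diffField _ j (algebraMap Poly3 Rat3 (MvPolynomial.X j)) := by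
  let := hcl.diffField
  refine ⟨?_, fun i hi => ?_, fun a => Subtype.ext (hk a.2)⟩
  · rw [partialD_X, if_pos rfl]
  · rw [partialD_X, if_neg hi]

theorem isDiffClosed_sup {k : IntermediateField ℂ Rat3} (hcl : IsDiffClosed k) {j : Fin 3}
    (hk : k ≤ kernelField j) :
    IsDiffClosed (k ⊔ ℂ⟮algebraMap Poly3 Rat3 (MvPolynomial.X j)⟯) := by
  let := hcl.diffField
  have := hcl.diffExtension_right
  have h := (isVariable_X hcl hk).isDiffClosed
  rw [← restrictScalars_adjoin_eq_sup]
  exact fun i a ha => h i a ha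

theorem exists_logForm_sub_mem {k : IntermediateField ℂ Rat3} (hcl : IsDiffClosed k) {j : Fin 3}
    (hk : k ≤ kernelField j) {α : OneForm Rat3}
    (hα : ∀ i, α i ∈ k ⊔ ℂ⟮algebraMap Poly3 Rat3 (MvPolynomial.X j)⟯) (hd : dOne α = 0) :
    ∃ δ ∈ logForms Rat3, ∀ i, (α - δ) i ∈ k := by
  let := hcl.diffField
  have := hcl.diffExtension_right
  rw [← restrictScalars_adjoin_eq_sup] at hα
  have hconst : ∀ a : k, IsConst a ↔ ∃ c : ℂ, algebraMap ℂ k c = a := fun a => by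
    constructor
    · intro ha
      obtain ⟨c, hc⟩ := exists_eq_C_of_isConst_rat (a := (a : Rat3)) fun i =>
        congrArg Subtype.val (ha i)
      refine ⟨c, Subtype.ext ?_⟩
      rw [hc, ← algebraMap_complex]
      rfl
    · rintro ⟨c, rfl⟩ i
      apply Subtype.ext
      change partialD i (algebraMap ℂ Rat3 c) = 0
      rw [algebraMap_complex]
      exact isConst_C c i
  obtain ⟨δ, hδ, α', h⟩ := (isVariable_X hcl hk).exists_logForm_add hconst hα hd
  refine ⟨δ, hδ, fun i => ?_⟩
  rw [h, add_sub_cancel_left]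
  exact (α' i).2

theorem eq_top_of_X_mem {N : IntermediateField ℂ Rat3}
    (h : ∀ j, algebraMap Poly3 Rat3 (MvPolynomial.X j) ∈ N) : N = ⊤ := by
  have hp : ∀ p : Poly3, algebraMap Poly3 Rat3 p ∈ N := fun p => by
    induction p using MvPolynomial.induction_on with
    | C c =>
      rw [← algebraMap_complex]
      exact IntermediateField.algebraMap_mem _ _
    | add p q hp hq =>
      rw [map_add]
      exact add_mem hp hq
    | mul_X p j hp =>
      rw [map_mul]
      exact mul_mem hp (h j)
  refine eq_top_iff.mpr fun a _ => ?_
  obtain ⟨p, q, -, rfl⟩ := FracDeriv.exists_div (A := Poly3) a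
  exact div_mem (hp p) (hp q)

/-- Closed rational 1-forms are sums of exact and logarithmic forms. -/
theorem mem_logForms_of_closed {α : OneForm Rat3} (hd : dOne α = 0) : α ∈ logForms Rat3 := by
  have hX : ∀ {i j : Fin 3}, i ≠ j →
      ℂ⟮algebraMap Poly3 Rat3 (MvPolynomial.X j)⟯ ≤ kernelField i := fun {i j} hij => by
    rw [adjoin_simple_le_iff]
    change partialD i _ = 0
    rw [partialD_X, if_neg hij]
  have hbot : IsDiffClosed (⊥ : IntermediateField ℂ Rat3) := by
    rintro i _ ⟨c, rfl⟩
    have : partialD i (algebraMap ℂ Rat3 c) = 0 := by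
      rw [algebraMap_complex]
      exact isConst_C c i
    change partialD i (algebraMap ℂ Rat3 c) ∈ _
    rw [this]
    exact zero_mem _
  have hk0 : (⊥ : IntermediateField ℂ Rat3) ≤ kernelField 0 := bot_le
  -- The chain ℂ ⊂ ℂ(x) ⊂ ℂ(x,y) ⊂ ℂ(x,y,z): each field is killed by the derivation in the next
  -- variable. The variables are then removed from the top.
  have hcl1 := isDiffClosed_sup hbot hk0
  have hk1 := sup_le (bot_le : _ ≤ kernelField 1) (hX (i := 1) (j := 0) (by decide))
  have hcl2 := isDiffClosed_sup hcl1 hk1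
  have hk2 := sup_le (sup_le (bot_le : _ ≤ kernelField 2) (hX (i := 2) (j := 0) (by decide)))
    (hX (i := 2) (j := 1) (by decide))
  have htop := eq_top_of_X_mem (N := ((⊥ ⊔ ℂ⟮algebraMap Poly3 Rat3 (MvPolynomial.X 0)⟯) ⊔
      ℂ⟮algebraMap Poly3 Rat3 (MvPolynomial.X 1)⟯) ⊔
      ℂ⟮algebraMap Poly3 Rat3 (MvPolynomial.X 2)⟯) fun j => by
    fin_cases j
    · exact (le_sup_right.trans (le_sup_left.trans le_sup_left) : ℂ⟮_⟯ ≤ _)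
        (mem_adjoin_simple_self _ _)
    · exact (le_sup_right.trans le_sup_left : ℂ⟮_⟯ ≤ _) (mem_adjoin_simple_self _ _)
    · exact (le_sup_right : ℂ⟮_⟯ ≤ _) (mem_adjoin_simple_self _ _)
  have hsub : ∀ {α δ : OneForm Rat3}, dOne α = 0 → δ ∈ logForms Rat3 → dOne (α - δ) = 0 :=
    fun hα hδ => by
      rw [sub_eq_add_neg, dOne_add, hα, dOne_neg, dOne_eq_zero_of_mem_logForms hδ, neg_zero,
        add_zero]
  obtain ⟨δ₂, hδ₂, h2⟩ := exists_logForm_sub_mem hcl2 hk2 (fun i => htop ▸ mem_top) hd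
  have hd2 := hsub hd hδ₂
  obtain ⟨δ₁, hδ₁, h1⟩ := exists_logForm_sub_mem hcl1 hk1 h2 hd2
  have hd1 := hsub hd2 hδ₁
  obtain ⟨δ₀, hδ₀, h0⟩ := exists_logForm_sub_mem hbot hk0 h1 hd1
  choose c hc using fun i => mem_bot.mp (h0 i)
  -- What remains has constant coefficients and is the differential of a linear polynomial.
  have hlin : α - δ₂ - δ₁ - δ₀ = ∑ j, dZero (algebraMap Poly3 Rat3
      (MvPolynomial.C (c j) * MvPolynomial.X j)) := by
    ext i
    rw [← hc i, Finset.sum_apply, Finset.sum_eq_single i]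
    · rw [dZero, map_mul, partialD_mul, partialD_X, if_pos rfl, isConst_C, mul_zero,
        add_zero, mul_one, algebraMap_complex]
    · intro j _ hj
      rw [dZero, map_mul, partialD_mul, partialD_X, if_neg hj.symm, isConst_C, mul_zero,
        mul_zero, add_zero]
    · exact fun h => absurd (Finset.mem_univ i) h
  have hlin' : α - δ₂ - δ₁ - δ₀ ∈ logForms Rat3 := by
    rw [hlin]
    exact sum_mem fun j _ => dZero_mem_logForms _
  have hα : α = (α - δ₂ - δ₁ - δ₀) + δ₀ + δ₁ + δ₂ := by abel
  rw [hα]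
  exact add_mem (add_mem (add_mem hlin' hδ₀) hδ₁) hδ₂

/-- The logarithmic differentials of Darboux functions. -/
def IsDarbouxForm (η : OneForm Rat3) : Prop :=
  ∃ (g f : Poly3) (k : ℕ) (p : Fin k → Poly3) (a : Fin k → ℂ),
    f ≠ 0 ∧ (∀ i, p i ≠ 0) ∧
    η = dZero (algebraMap Poly3 Rat3 g / algebraMap Poly3 Rat3 f) +
        ∑ i, (algebraMap ℂ Rat3 (a i) / algebraMap Poly3 Rat3 (p i)) •
          dZero (algebraMap Poly3 Rat3 (p i))

theorem dZero_add {F : Type u} [Field F] [DiffField F] (a b : F) :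
    dZero (a + b) = dZero a + dZero b :=
  funext fun i => map_add (partialD i) a b

theorem IsDarbouxForm.add {η θ : OneForm Rat3} (hη : IsDarbouxForm η) (hθ : IsDarbouxForm θ) :
    IsDarbouxForm (η + θ) := by
  obtain ⟨g, f, k, p, a, hf, hp, rfl⟩ := hη
  obtain ⟨g', f', k', p', a', hf', hp', rfl⟩ := hθ
  refine ⟨g * f' + f * g', f * f', k + k', Fin.append p p', Fin.append a a', mul_ne_zero hf hf',
    fun i => ?_, ?_⟩
  · refine Fin.addCases (fun i => ?_) (fun i => ?_) i
    · rw [Fin.append_left]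
      exact hp i
    · rw [Fin.append_right]
      exact hp' i
  · rw [Fin.sum_univ_add]
    simp only [Fin.append_left, Fin.append_right]
    rw [map_add, map_mul, map_mul, map_mul, ← div_add_div _ _ (FracDeriv.algebraMap_ne hf)
      (FracDeriv.algebraMap_ne hf'), dZero_add]
    abel

theorem IsDarbouxForm.neg {η : OneForm Rat3} (hη : IsDarbouxForm η) : IsDarbouxForm (-η) := by
  obtain ⟨g, f, k, p, a, hf, hp, rfl⟩ := hη
  refine ⟨-g, f, k, p, -a, hf, hp, ?_⟩
  rw [neg_add, ← Finset.sum_neg_distrib]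
  congr 1
  · rw [map_neg (algebraMap Poly3 Rat3), neg_div (algebraMap Poly3 Rat3 f)]
    exact funext fun i => (map_neg (partialD (L := Rat3) i) _).symm
  · refine Finset.sum_congr rfl fun i _ => ?_
    rw [Pi.neg_apply, map_neg, neg_div (algebraMap Poly3 Rat3 (p i)), neg_smul]

theorem isDarbouxForm_dZero (u : Rat3) : IsDarbouxForm (dZero u) := by
  obtain ⟨g, f, hf, rfl⟩ := FracDeriv.exists_div (A := Poly3) u
  exact ⟨g, f, 0, Fin.elim0, Fin.elim0, hf, fun i => i.elim0, by simp⟩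

theorem isDarbouxForm_poly (c : ℂ) {p : Poly3} (hp : p ≠ 0) :
    IsDarbouxForm ((algebraMap ℂ Rat3 c / algebraMap Poly3 Rat3 p) •
      dZero (algebraMap Poly3 Rat3 p)) := by
  refine ⟨0, 1, 1, fun _ => p, fun _ => c, one_ne_zero, fun _ => hp, ?_⟩
  have : dZero (0 : Rat3) = 0 := funext fun i => map_zero (partialD i)
  simp [this]

/-- For f = p/q one has c df/f = c dp/p − c dq/q, so polynomial arguments suffice; the exact parts
are put over a common denominator. -/
theorem isDarbouxForm_of_mem_logForms {η : OneForm Rat3} (hη : η ∈ logForms Rat3) :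
    IsDarbouxForm η := by
  have hzero : IsDarbouxForm 0 := by
    have := isDarbouxForm_dZero 0
    rwa [show dZero (0 : Rat3) = 0 from funext fun i => map_zero (partialD i)] at this
  induction hη using AddSubgroup.closure_induction with
  | mem η h =>
    rcases h with ⟨u, rfl⟩ | ⟨c, f, hc, rfl⟩
    · exact isDarbouxForm_dZero u
    · by_cases hf : f = 0
      · rwa [hf, div_zero, zero_smul]
      obtain ⟨c, rfl⟩ := exists_eq_C_of_isConst_rat hc
      obtain ⟨p, q, hq, rfl⟩ := FracDeriv.exists_div (A := Poly3) f
      have hp : p ≠ 0 := by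
        rintro rfl
        simp at hf
      have hp' := FracDeriv.algebraMap_ne (F := Rat3) hp
      have hq' := FracDeriv.algebraMap_ne (F := Rat3) hq
      have := (isDarbouxForm_poly c hp).add (isDarbouxForm_poly c hq).neg
      convert this using 1
      ext i
      simp only [Pi.add_apply, Pi.neg_apply, Pi.smul_apply, smul_eq_mul, dZero,
        partialD_div _ _ _ hq', algebraMap_complex]
      field_simp
      ring
  | zero => exact hzero
  | add a b _ _ ha hb => exact ha.add hb
  | neg a _ ha => exact ha.neg

end RationalForms

end LiouvillianForms

/-! ### The theorem. -/

open LiouvillianForms in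
theorem theorem3p4 (P Q R : Rat3) (Ω : TwoForm Rat3) (hΩ : Ω = ![P, Q, R])
    (h : HasLiouvillianFirstIntegral.{u} Ω) :
    (∃ ω α : OneForm Rat3,
      ω ≠ 0 ∧ wedgeOneTwo ω Ω = 0 ∧ wedgeOneOne α ω = dOne ω ∧ dOne α = 0 ∧
      ∃ (L : Type) (_ : Field L) (_ : DiffField L) (_ : Algebra Rat3 L),
        IsLiouvillianExtension Rat3 L ∧
        ∃ m φ : L, IsDarbouxFunction m ∧ m⁻¹ • dZero m = formMap L α ∧
          dZero φ = m⁻¹ • formMap L ω ∧ IsFirstIntegral Ω φ) ∨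
    (∃ β : OneForm Rat3,
      dTwo Ω = wedgeOneTwo β Ω ∧ dOne β = 0 ∧
      ∃ (L : Type) (_ : Field L) (_ : DiffField L) (_ : Algebra Rat3 L),
        IsLiouvillianExtension Rat3 L ∧
        ∃ m : L, IsDarbouxFunction m ∧ m⁻¹ • dZero m = formMap L β ∧
          IsInverseJacobiMultiplier Ω m) := by
  have hgood : HasClosedMultiplier Ω := by
    obtain ⟨L, _, _, _, hL, φ, hφ, hφΩ⟩ := h
    have := hL.diffExtension
    obtain ⟨m, E, h0, hm, hstep⟩ := hL.tower
    refine hasClosedMultiplier_of_tower h0 hm hstep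
      (hasClosedMultiplier_of_closed (w := dZero φ) (fun hd => hφ fun i => congrFun hd i) hφΩ
        (dOne_dZero φ))
  rcases hgood with ⟨ω, α, hω0, hωΩ, hdω, hdα⟩ | ⟨β, hβ, hdβ⟩
  · obtain ⟨L, _, _, _, hL, m, φ, hm0, hm, hφ⟩ := exists_liouvillian_solution hdα hdω
    refine Or.inl ⟨ω, α, hω0, hωΩ, hdω, hdα, L, _, _, _, hL, m, φ, ?_, hm, hφ, ?_, ?_⟩
    · obtain ⟨g, f, k, p, a, hf, hp, hη⟩ :=
        isDarbouxForm_of_mem_logForms (mem_logForms_of_closed hdα)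
      exact ⟨hm0, g, f, k, p, a, hf, hp, hη ▸ hm⟩
    · intro hc
      have hz : dZero φ = 0 := funext hc
      rw [hz] at hφ
      have h0 := (smul_eq_zero.mp hφ.symm).resolve_left (inv_ne_zero hm0)
      exact hω0 (formMap_injective (h0.trans formMap_zero.symm))
    · have h1 := wedgeOneTwo_formMap (F := L) ω Ω
      rw [hωΩ, map_zero] at h1
      rw [hφ]
      simp only [wedgeOneTwo, Pi.smul_apply, smul_eq_mul] at h1 ⊢
      linear_combination m⁻¹ * h1
  -- Only `m` is needed here, so the form to be integrated is taken to be 0.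
  · obtain ⟨L, _, _, _, hL, m, -, hm0, hm, -⟩ := exists_liouvillian_solution (ω := 0) hdβ (by
      rw [wedgeOneOne_eq_dOne_iff]
      simp)
    have := hL.diffExtension
    refine Or.inr ⟨β, hβ, hdβ, L, _, _, _, hL, m, ?_, hm, hm0, ?_⟩
    · obtain ⟨g, f, k, p, a, hf, hp, hη⟩ :=
        isDarbouxForm_of_mem_logForms (mem_logForms_of_closed hdβ)
      exact ⟨hm0, g, f, k, p, a, hf, hp, hη ▸ hm⟩
    -- d(Ω/m) = (dΩ − (dm/m) ∧ Ω)/m, which vanishes since dm/m = β.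
    · have h1 := dTwo_formMap (F := L) Ω
      rw [hβ, ← wedgeOneTwo_formMap, ← hm] at h1
      simp only [dTwo, wedgeOneTwo, Pi.smul_apply, smul_eq_mul, dZero, Derivation.leibniz,
        partialD_inv] at h1 ⊢
      field_simp at h1 ⊢
      linear_combination h1
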